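/- A quasimodular form of weight $w$ and depth $s$ (for $\mathrm{SL}_2(\mathbb{Z})$) is a holomorphic function $F$ on the upper half-plane $\mathcal{H}$ for which there are holomorphic functions $F_0,\dots,F_s$ on $\mathcal{H}$, all bounded as $\operatorname{Im} z\to\infty$ and with $F_s\neq 0$, such that $$(cz+d)^{-w}F\Big(\frac{az+b}{cz+d}\Big)=\sum_{r=0}^{s}F_r(z)\Big(\frac{c}{cz+d}\Big)^r\qquad\text{for all }\begin{pmatrix}a&b\\c&d\end{pmatrix}\in \mathrm{SL}_2(\mathbb{Z}),\ z\in\mathcal{H}.$$ Such an $F$ has a Fourier expansion $F=\sum_{n\ge0}a_nq^n$, $q=e^{2\pi i z}$; it is called extremal if its vanishing order at infinity (the least $n$ with $a_n\ne0$) is the highest among all quasimodular forms of the same weight and depth, and normalized extremal if moreover its first nonzero Fourier coefficient is $1$. Proposition. For every even integer $w\ge 12$ there is a unique normalized extremal quasimodular form $X_{w,1}$ of weight $w$ and depth $1$; it takes real values on the positive imaginary axis, and the function $t\mapsto t^{w-1}X_{w,1}(it)$ is (strictly) monotone decreasing near $t=0$, i.e. on $(0,\varepsilon)$ for some $\varepsilon>0$.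 -/

import Mathlib

open UpperHalfPlane
open scoped MatrixGroups ModularForm Manifold

/-- `F : ℍ → ℂ` is a quasimodular form of weight `k`, depth (exactly) `s` and level `SL(2, ℤ)`:
it is holomorphic, and there are holomorphic functions `F₀, …, F_s` on `ℍ` with `F_s ≠ 0`
such that, for all `γ = (a b; c d)` in `SL(2, ℤ)`,
`(c z + d)⁻ᵏ F(γ z) = ∑_{r ≤ s} F_r(z) (c / (c z + d))ʳ`,
and the usual growth condition at the only cusp holds: every `F_r` (in particular
`F = F₀`, the case `γ = 1`) is bounded as `Im z → ∞`. -/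
def IsQuasimodularForm (k : ℤ) (s : ℕ) (F : ℍ → ℂ) : Prop :=
  MDiff F ∧ ∃ G : Fin (s + 1) → ℍ → ℂ,
    (∀ r, MDiff (G r) ∧ IsBoundedAtImInfty (G r)) ∧
    G (Fin.last s) ≠ 0 ∧
    ∀ (γ : SL(2, ℤ)) (z : ℍ),
      (F ∣[k] γ) z = ∑ r : Fin (s + 1), G r z * (((γ 1 0 : ℤ) : ℂ) / denom γ z) ^ (r : ℕ)

/-- The vanishing order of `F` at infinity: the order in `q` of its Fourier expansion
`∑ aₙ qⁿ`, `q = exp (2 π i z)`. -/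
noncomputable def vanishingOrder (F : ℍ → ℂ) : ℕ∞ :=
  (qExpansion 1 F).order

/-- `F` is an extremal quasimodular form of weight `k` and depth `s` (level `SL(2, ℤ)`): it has
the highest vanishing order at infinity among all quasimodular forms of that weight and depth. -/
def IsExtremal (k : ℤ) (s : ℕ) (F : ℍ → ℂ) : Prop :=
  IsQuasimodularForm k s F ∧
    ∀ G : ℍ → ℂ, IsQuasimodularForm k s G → vanishingOrder G ≤ vanishingOrder F

/-- `F` is a normalized extremal quasimodular form of weight `k` and depth `s`: it is extremal,
and its first nonzero Fourier coefficient is `1`. -/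
def IsNormalizedExtremal (k : ℤ) (s : ℕ) (F : ℍ → ℂ) : Prop :=
  IsExtremal k s F ∧
    ∃ m : ℕ, (∀ n < m, (qExpansion 1 F).coeff n = 0) ∧ (qExpansion 1 F).coeff m = 1

/-- The restriction `t ↦ F(it)` of `F` to the positive imaginary axis (relevant for `t > 0`). -/
noncomputable def onImAxis (F : ℍ → ℂ) (t : ℝ) : ℂ :=
  F (ofComplex (Complex.I * t))

/-!
A quasimodular form of depth at most one is `F = f + E₂ G` with `f`, `G` modular of weights `k` and
`k - 2`. It is encoded here as a pair `(F, G)` with `F ∣[k] γ = F + κ G D₂(γ)`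
(`IsQuasimodularPair`); the cocycle relation for `D₂` then forces `G` to be modular.

*Upper bound for the order.* Up to a constant multiple of `G`, the vector `(z F + G, F)` transforms
under the standard representation of `SL(2, ℤ)` in weight `k - 1`, so its Wronskian
`F² + 12 (F DG - G DF)` is a modular form of weight `2 k`. Its order is at least that of `F`, and it
vanishes only if `F` does. Since a nonzero modular form of weight `2 k` has order at most
`2 k / 12`, a nonzero `F` has order at most `k / 6` (`IsQuasimodularPair.left_eq_zero`). This gives
uniqueness of a normalized form of order `⌊k / 6⌋`.

*Existence.* The Serre derivative `∂ = ∂ₖ₋₁` maps pairs of weight `k` to pairs of weight `k + 2`. If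
`X` has weight `6 n` and order `n`, then `∂∂X - ((36 n² - 1) / 144) E₄ X` has weight `6 n + 4` and
order larger than `n`, so it is zero. This differential equation determines the coefficient of
`qⁿ⁺¹` in `X` and relates the first two coefficients of the second component `G`. Multiples of `∂X`
and `E₄ X` are extremal of weights `6 n + 2` and `6 n + 4`, and a multiple of `E₆ X - E₄ ∂X`, with
`∂X` normalized, is extremal of weight `6 n + 6` because the coefficient of `qⁿ⁺¹` is explicit and
nonzero. Starting from the pair `(1, 0)` one gets all weights, and the recursion shows that the
constant term of `G` in weight `6 n` has sign `(-1)ⁿ⁺¹` (`IsExtremalPair.exists_weight_six_mul`).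

*Behaviour near `t = 0`.* For `u = 1 / t` the transformation under `z ↦ -1 / z` reads
`t ^ (w - 1) X(it) = (-1) ^ (w / 2) (u X(iu) - (6 / π) G(iu))`. As `X = O(q²)`, the derivative in
`u` of the bracket is asymptotic to `12 b q` with `b` the coefficient of `q` in `G`, and
`(-1) ^ (w / 2) b` is positive by the differential equation and the sign of the constant term
(`IsExtremalPair.exists_of_even`). The only exception is `w = 14`, where `b = 0`; there `X = q² + …`
and the term `-4 π u q²` coming from `u X(iu)` dominates, again with the right sign.
-/

local notation "𝔇" => Derivative.normalizedDerivOfComplex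
local notation "∂[" s "]" => Derivative.serreDerivative s
local notation "𝓔₂" => EisensteinSeries.E2
local notation "𝔡" => EisensteinSeries.D2
local notation "E4" => ModularForm.E₄
local notation "E6" => ModularForm.E₆

/-! ### Holomorphic functions with a `q`-expansion -/

/-- `F` is holomorphic on `ℍ`, invariant under `z ↦ z + 1` and bounded at `i∞`: exactly the
functions that are given on all of `ℍ` by a power series in `q = exp (2 π i z)`. -/
structure HasQSeries (F : ℍ → ℂ) : Prop where
  mdiff : MDiff F
  bdd : IsBoundedAtImInfty F
  periodic : Function.Periodic (F ∘ ofComplex) ((1 : ℝ) : ℂ)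

namespace HasQSeries

variable {F G : ℍ → ℂ}

lemma analyticAt (hF : HasQSeries F) : AnalyticAt ℂ (cuspFunction 1 F) 0 :=
  analyticAt_cuspFunction_zero one_pos hF.periodic hF.mdiff hF.bdd

lemma hasSum (hF : HasQSeries F) (z : ℍ) :
    HasSum (fun m : ℕ ↦ (qExpansion 1 F).coeff m • Function.Periodic.qParam 1 z ^ m) (F z) :=
  hasSum_qExpansion one_pos hF.periodic hF.mdiff hF.bdd z

lemma add (hF : HasQSeries F) (hG : HasQSeries G) : HasQSeries (F + G) where
  mdiff := hF.mdiff.add hG.mdiff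
  bdd := Asymptotics.IsBigO.add hF.bdd hG.bdd
  periodic := fun z ↦ by simpa using congr_arg₂ (· + ·) (hF.periodic z) (hG.periodic z)

lemma mul (hF : HasQSeries F) (hG : HasQSeries G) : HasQSeries (F * G) where
  mdiff := hF.mdiff.mul hG.mdiff
  bdd := Filter.BoundedAtFilter.mul hF.bdd hG.bdd
  periodic := fun z ↦ by simpa using congr_arg₂ (· * ·) (hF.periodic z) (hG.periodic z)

lemma smul (hF : HasQSeries F) (c : ℂ) : HasQSeries (c • F) where
  mdiff := hF.mdiff.const_smul c
  bdd := Asymptotics.IsBigO.const_smul_left hF.bdd c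
  periodic := fun z ↦ by simpa using Or.inl (hF.periodic z)

lemma sub (hF : HasQSeries F) (hG : HasQSeries G) : HasQSeries (F - G) := by
  rw [show F - G = F + (-1 : ℂ) • G by ext; simp [sub_eq_add_neg]]
  exact hF.add (hG.smul _)

lemma of_hasSum {c : ℕ → ℂ} (hm : MDiff F)
    (hF : ∀ z : ℍ, HasSum (fun m ↦ c m • Function.Periodic.qParam 1 z ^ m) (F z)) :
    HasQSeries F where
  mdiff := hm
  bdd := isBoundedAtImInfty_of_hasSum_qExpansion one_pos hF
  periodic w := by
    by_cases! hw : 0 < w.im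
    · have hw' : 0 < (w + (1 : ℝ)).im := by simpa using hw
      simp only [Function.comp_apply, ofComplex_apply_of_im_pos hw, ofComplex_apply_of_im_pos hw']
      refine (hF _).unique ?_
      convert! hF ⟨w, hw⟩ using 4
      simp [Function.Periodic.qParam, mul_add, Complex.exp_add]
    · have hw' : (w + (1 : ℝ)).im ≤ 0 := by simpa using hw
      simp only [Function.comp_apply, ofComplex_apply_of_im_nonpos hw,
        ofComplex_apply_of_im_nonpos hw']

lemma coeff_of_hasSum {c : ℕ → ℂ} (hF' : HasQSeries F)
    (hF : ∀ z : ℍ, HasSum (fun m ↦ c m • Function.Periodic.qParam 1 z ^ m) (F z)) (m : ℕ) :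
    (qExpansion 1 F).coeff m = c m := by
  have h1 := hasFPowerSeriesOnBall_cuspFunction one_pos hF'.analyticAt hF
  have h2 := hasFPowerSeriesOnBall_cuspFunction one_pos hF'.analyticAt hF'.hasSum
  simpa using congr_arg (FormalMultilinearSeries.coeff · m)
    (h2.hasFPowerSeriesAt.eq_formalMultilinearSeries h1.hasFPowerSeriesAt)

lemma qExpansion_eq_zero (hF : HasQSeries F) (h : qExpansion 1 F = 0) : F = 0 :=
  (qExpansion_eq_zero_iff one_pos hF.periodic hF.mdiff hF.bdd).mp h

lemma qExpansion_add (hF : HasQSeries F) (hG : HasQSeries G) :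
    qExpansion 1 (F + G) = qExpansion 1 F + qExpansion 1 G :=
  UpperHalfPlane.qExpansion_add hF.analyticAt hG.analyticAt

lemma qExpansion_sub (hF : HasQSeries F) (hG : HasQSeries G) :
    qExpansion 1 (F - G) = qExpansion 1 F - qExpansion 1 G :=
  UpperHalfPlane.qExpansion_sub hF.analyticAt hG.analyticAt

lemma qExpansion_mul (hF : HasQSeries F) (hG : HasQSeries G) :
    qExpansion 1 (F * G) = qExpansion 1 F * qExpansion 1 G :=
  UpperHalfPlane.qExpansion_mul hF.analyticAt hG.analyticAt

lemma qExpansion_smul (hF : HasQSeries F) (c : ℂ) :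
    qExpansion 1 (c • F) = c • qExpansion 1 F :=
  UpperHalfPlane.qExpansion_smul hF.analyticAt c

/-- Termwise differentiation of the `q`-expansion. -/
lemma hasSum_deriv (hF : HasQSeries F) (z : ℍ) :
    HasSum (fun m : ℕ ↦ ((m : ℂ) * (qExpansion 1 F).coeff m) •
      Function.Periodic.qParam 1 z ^ m) (𝔇 F z) := by
  set q := Function.Periodic.qParam 1 (z : ℂ) with hq
  set f := cuspFunction 1 F with hf
  have hq1 : ‖q‖ < 1 := Function.Periodic.norm_qParam_lt_one one_pos z.im_pos
  have hd : DifferentiableOn ℂ f (Metric.ball 0 1) :=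
    differentiableOn_cuspFunction_ball one_pos hF.periodic hF.mdiff hF.bdd
  -- by the chain rule, `D` becomes `q d/dq` on functions of `q`
  have hval : 𝔇 F z = q * deriv f q := by
    have h1 : F ∘ ofComplex =ᶠ[nhds (z : ℂ)] fun w ↦ f (Function.Periodic.qParam 1 w) := by
      filter_upwards [isOpen_upperHalfPlaneSet.mem_nhds z.im_pos] with w hw
      have := eq_cuspFunction (h := 1) ⟨w, hw⟩ one_ne_zero hF.periodic
      simpa [ofComplex_apply_of_im_pos hw] using! this.symm
    have h2 : HasDerivAt (Function.Periodic.qParam 1) (2 * Real.pi * Complex.I * q) (z : ℂ) := by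
      have : HasDerivAt (fun w : ℂ ↦ Complex.exp (2 * Real.pi * Complex.I * w / (1 : ℝ)))
          (Complex.exp (2 * Real.pi * Complex.I * z / (1 : ℝ)) *
            (2 * Real.pi * Complex.I * 1 / (1 : ℝ))) (z : ℂ) :=
        (((hasDerivAt_id (z : ℂ)).const_mul _).div_const _).cexp
      convert! this using 1
      simp [hq, Function.Periodic.qParam, mul_comm]
    have h3 : HasDerivAt f (deriv f q) q :=
      (hd.differentiableAt (Metric.isOpen_ball.mem_nhds (by simpa using hq1))).hasDerivAt
    have h4 := (HasDerivAt.comp (z : ℂ) h3 h2).congr_of_eventuallyEq h1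
    rw [Derivative.normalizedDerivOfComplex, h4.deriv]
    have : (2 * Real.pi * Complex.I : ℂ) ≠ 0 := Complex.two_pi_I_ne_zero
    field_simp
  have hsum := Complex.hasSum_taylorSeries_on_ball (hd.deriv Metric.isOpen_ball)
    (z := q) (r := 1) (by simpa using hq1)
  rw [hval]
  have h0 : ((0 : ℕ) * (qExpansion 1 F).coeff 0 : ℂ) • q ^ 0 = 0 := by simp
  rw [hasSum_nat_add_iff' 1 |>.symm]
  simp only [Finset.range_one, Finset.sum_singleton, h0, sub_zero]
  convert! hsum.mul_left q using 2 with m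
  rw [qExpansion_coeff, ← iteratedDeriv_succ', Nat.factorial_succ, sub_zero]
  simp only [smul_eq_mul]
  push_cast
  have : ((m : ℂ) + 1) ≠ 0 := by exact_mod_cast Nat.succ_ne_zero m
  rw [← hf]
  field_simp
  ring

lemma deriv (hF : HasQSeries F) : HasQSeries (𝔇 F) :=
  of_hasSum (Derivative.normalizedDerivOfComplex_mdifferentiable hF.mdiff) hF.hasSum_deriv

lemma coeff_deriv (hF : HasQSeries F) (m : ℕ) :
    (qExpansion 1 (𝔇 F)).coeff m = m * (qExpansion 1 F).coeff m :=
  hF.deriv.coeff_of_hasSum hF.hasSum_deriv m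

lemma of_modularForm {k : ℤ} (f : ModularForm 𝒮ℒ k) : HasQSeries f where
  mdiff := f.holo'
  bdd := ModularFormClass.bdd_at_infty f
  periodic := SlashInvariantFormClass.periodic_comp_ofComplex f
    one_mem_strictPeriods_SL

end HasQSeries

lemma hasSum_E2 (z : ℍ) : HasSum (fun m : ℕ ↦
    (if m = 0 then 1 else -24 * (ArithmeticFunction.sigma 1 m : ℂ)) •
      Function.Periodic.qParam 1 z ^ m) (𝓔₂ z) := by
  simpa [Function.Periodic.qParam] using EisensteinSeries.hasSum_qExpansion_E2 z

lemma hasQSeries_E2 : HasQSeries 𝓔₂ :=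
  .of_hasSum E2_mdifferentiable hasSum_E2

lemma qExpansion_E2_coeff (m : ℕ) : (qExpansion 1 𝓔₂).coeff m =
    if m = 0 then 1 else -24 * (ArithmeticFunction.sigma 1 m : ℂ) :=
  hasQSeries_E2.coeff_of_hasSum hasSum_E2 m

lemma serreDerivative_eq_sub (s : ℂ) (F : ℍ → ℂ) :
    ∂[s] F = 𝔇 F - (s / 12) • (𝓔₂ * F) := by
  ext z
  simp [Derivative.serreDerivative]
  ring

lemma HasQSeries.serre {F : ℍ → ℂ} (hF : HasQSeries F) (s : ℂ) : HasQSeries (∂[s] F) := by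
  rw [serreDerivative_eq_sub]
  exact hF.deriv.sub ((hasQSeries_E2.mul hF).smul _)

/-! ### The cocycle of `E₂` and slash actions -/

/-- The constant `-3 / π²` in the transformation law `E₂ ∣[2] γ = E₂ + κ D₂(γ)`, where
`D₂(γ)(z) = 2 π i c / (c z + d)`. -/
noncomputable def kappa : ℂ := -3 / (Real.pi : ℂ) ^ 2

local notation "κ" => kappa

lemma kappa_eq : κ = 12 * (2 * Real.pi * Complex.I : ℂ)⁻¹ ^ 2 := by
  have : (Real.pi : ℂ) ≠ 0 := by exact_mod_cast Real.pi_ne_zero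
  rw [kappa]
  field_simp
  rw [Complex.I_sq]
  norm_num

lemma kappa_ne_zero : κ ≠ 0 := by
  rw [kappa_eq]
  exact mul_ne_zero (by norm_num) (pow_ne_zero _ (inv_ne_zero Complex.two_pi_I_ne_zero))

lemma mul_slash_apply {k a b : ℤ} (h : k = a + b) (γ : SL(2, ℤ)) (F G : ℍ → ℂ) (z : ℍ) :
    ((F * G) ∣[k] γ) z = (F ∣[a] γ) z * (G ∣[b] γ) z := by
  rw [h, ModularForm.mul_slash_SL2, Pi.mul_apply]

lemma add_slash_apply (k : ℤ) (γ : SL(2, ℤ)) (F G : ℍ → ℂ) (z : ℍ) :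
    ((F + G) ∣[k] γ) z = (F ∣[k] γ) z + (G ∣[k] γ) z := by
  rw [SlashAction.add_slash, Pi.add_apply]

lemma sub_slash_apply (k : ℤ) (γ : SL(2, ℤ)) (F G : ℍ → ℂ) (z : ℍ) :
    ((F - G) ∣[k] γ) z = (F ∣[k] γ) z - (G ∣[k] γ) z := by
  simp only [ModularForm.SL_slash_apply, Pi.sub_apply, sub_mul]

lemma smul_slash_apply (k : ℤ) (γ : SL(2, ℤ)) (c : ℂ) (F : ℍ → ℂ) (z : ℍ) :
    ((c • F) ∣[k] γ) z = c * (F ∣[k] γ) z := by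
  rw [ModularForm.SL_smul_slash, Pi.smul_apply, smul_eq_mul]

lemma E2_slash_apply (γ : SL(2, ℤ)) (z : ℍ) : (𝓔₂ ∣[(2 : ℤ)] γ) z = 𝓔₂ z + κ * 𝔡 γ z := by
  have : (Real.pi : ℂ) ≠ 0 := by exact_mod_cast Real.pi_ne_zero
  rw [EisensteinSeries.E2_slash_action, riemannZeta_two, kappa]
  simp only [Pi.sub_apply, Pi.smul_apply, smul_eq_mul]
  field_simp
  ring

/-- The cocycle `D₂(γ)` is a multiple of `1 ∣[1] γ`, which reduces its holomorphy and its derivative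
to facts about slash actions. -/
lemma D2_eq_smul_slash (γ : SL(2, ℤ)) :
    𝔡 γ = (2 * Real.pi * Complex.I * ((γ 1 0 : ℤ) : ℂ)) • ((1 : ℍ → ℂ) ∣[(1 : ℤ)] γ) := by
  ext z
  simp [EisensteinSeries.D2, ModularForm.SL_slash_apply, div_eq_mul_inv]

lemma mdiff_slash {F : ℍ → ℂ} (hF : MDiff F) (k : ℤ) (γ : SL(2, ℤ)) : MDiff (F ∣[k] γ) :=
  MDifferentiable.slash hF k _

lemma mdiff_one : MDiff (1 : ℍ → ℂ) := mdifferentiable_const (c := (1 : ℂ))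

lemma mdiff_D2 (γ : SL(2, ℤ)) : MDiff (𝔡 γ) := by
  rw [D2_eq_smul_slash]
  exact (mdiff_slash mdiff_one 1 γ).const_smul _

/-- `D` commutes with the slash action up to a multiple of the cocycle of `E₂`. -/
lemma deriv_slash_apply {F : ℍ → ℂ} (hF : MDiff F) (k : ℤ) (γ : SL(2, ℤ)) (z : ℍ) :
    (𝔇 F ∣[k + 2] γ) z = 𝔇 (F ∣[k] γ) z + k * κ / 12 * 𝔡 γ z * (F ∣[k] γ) z := by
  have := Complex.two_pi_I_ne_zero
  rw [Derivative.normalizedDerivOfComplex_SL_slash hF, kappa_eq]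
  simp only [Pi.sub_apply, EisensteinSeries.D2]
  field_simp
  ring

lemma deriv_D2_apply (γ : SL(2, ℤ)) (z : ℍ) : 𝔇 (𝔡 γ) z = -(κ / 12) * 𝔡 γ z ^ 2 := by
  have h0 := Complex.two_pi_I_ne_zero
  have h1 : 𝔇 (1 : ℍ → ℂ) = 0 := Derivative.normalizedDerivOfComplex_const 1
  have h2 := deriv_slash_apply mdiff_one 1 γ z
  have h3 := denom_ne_zero (γ : GL (Fin 2) ℝ) z
  rw [h1, SlashAction.zero_slash, Pi.zero_apply] at h2
  have h4 := eq_neg_of_add_eq_zero_left h2.symm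
  conv_lhs => rw [D2_eq_smul_slash]
  rw [Derivative.normalizedDerivOfComplex_smul _ _ (mdiff_slash mdiff_one 1 γ), Pi.smul_apply, h4]
  simp [EisensteinSeries.D2, ModularForm.SL_slash_apply]
  field_simp

/-- Differentiating a transformed depth-one form `F + κ G D₂(γ)`. -/
lemma deriv_add_smul_mul_D2 {F G : ℍ → ℂ} (hF : MDiff F) (hG : MDiff G) (γ : SL(2, ℤ)) (z : ℍ) :
    𝔇 (F + κ • (G * 𝔡 γ)) z =
      𝔇 F z + κ * (𝔇 G z * 𝔡 γ z - κ / 12 * G z * 𝔡 γ z ^ 2) := by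
  have h := hG.mul (mdiff_D2 γ)
  rw [Derivative.normalizedDerivOfComplex_add _ _ hF (h.const_smul _),
    Derivative.normalizedDerivOfComplex_smul _ _ h,
    Derivative.normalizedDerivOfComplex_mul _ _ hG (mdiff_D2 γ)]
  simp only [Pi.add_apply, Pi.smul_apply, Pi.mul_apply, smul_eq_mul, deriv_D2_apply]
  ring

/-! ### Level one forms with vanishing leading coefficients -/

/-- A `q`-series invariant under the weight `k` action of `SL(2, ℤ)` is a modular form. -/
noncomputable def HasQSeries.toModularForm {F : ℍ → ℂ} (hF : HasQSeries F) (k : ℤ)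
    (hs : ∀ γ : SL(2, ℤ), F ∣[k] γ = F) : ModularForm 𝒮ℒ k where
  toFun := F
  slash_action_eq' := by
    rintro _ ⟨γ, rfl⟩
    exact hs γ
  holo' := hF.mdiff
  bdd_at_cusps' {c} hc := by
    rw [OnePoint.isBoundedAt_iff_forall_SL2Z hc]
    intro γ _
    exact (hs γ).symm ▸ hF.bdd

/-- The level one Sturm bound for functions given by `q`-series. -/
lemma HasQSeries.eq_zero_of_slash_invariant {F : ℍ → ℂ} (hF : HasQSeries F) (k : ℕ)
    (hs : ∀ γ : SL(2, ℤ), F ∣[(k : ℤ)] γ = F)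
    (h0 : ∀ m ≤ k / 12, (qExpansion 1 F).coeff m = 0) : F = 0 := by
  have : hF.toModularForm k hs = 0 := by
    refine ModularForm.sturm_bound_levelOne_nat ?_
    refine lt_of_lt_of_le (b := ((k / 12 + 1 : ℕ) : ℕ∞)) (by exact_mod_cast Nat.lt_succ_self _) ?_
    exact PowerSeries.nat_le_order _ _ fun i hi ↦ h0 i (Nat.lt_succ_iff.mp hi)
  ext z
  exact DFunLike.congr_fun this z

/-! ### Quasimodular pairs of depth at most one -/

/-- `(F, G)` is a quasimodular pair of weight `k`: `F = f + E₂ G` with `f` modular of weight `k`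
and `G` modular of weight `k - 2`, expressed through the transformation law of `F` alone. -/
structure IsQuasimodularPair (k : ℤ) (F G : ℍ → ℂ) : Prop where
  left : HasQSeries F
  right : HasQSeries G
  slash : ∀ γ : SL(2, ℤ), F ∣[k] γ = F + κ • (G * 𝔡 γ)

namespace IsQuasimodularPair

variable {k : ℤ} {F G F' G' : ℍ → ℂ}

lemma slash_apply (h : IsQuasimodularPair k F G) (γ : SL(2, ℤ)) (z : ℍ) :
    (F ∣[k] γ) z = F z + κ * (G z * 𝔡 γ z) := by
  simp [h.slash γ]

lemma D2_S_slash_ne_zero (γ : SL(2, ℤ)) (z : ℍ) :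
    (𝔡 ModularGroup.S ∣[(2 : ℤ)] γ) z ≠ 0 := by
  have h1 := denom_ne_zero (γ : GL (Fin 2) ℝ) z
  have h2 := Complex.two_pi_I_ne_zero
  have h3 := ne_zero (γ • z)
  rw [ModularForm.SL_slash_apply, EisensteinSeries.D2_S]
  exact mul_ne_zero (div_ne_zero h2 h3) (zpow_ne_zero _ h1)

/-- The cocycle relation shows that the second component of a pair is modular. -/
lemma right_slash_apply_of_slash (h : ∀ γ : SL(2, ℤ), F ∣[k] γ = F + κ • (G * 𝔡 γ))
    (γ : SL(2, ℤ)) (z : ℍ) : (G ∣[k - 2] γ) z = G z := by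
  -- compare the two ways to compute `F ∣[k] (S γ)`; `S` is used because `D₂(S)` has no zeros
  have h1 : F ∣[k] (ModularGroup.S * γ) = (F ∣[k] ModularGroup.S) ∣[k] γ :=
    SlashAction.slash_mul k _ _ F
  have h2 := congr_fun h1 z
  rw [h, h, add_slash_apply, h γ, smul_slash_apply,
    mul_slash_apply (show k = k - 2 + 2 by ring), EisensteinSeries.D2_mul] at h2
  simp only [Pi.add_apply, Pi.smul_apply, Pi.mul_apply, smul_eq_mul] at h2
  have h3 := D2_S_slash_ne_zero γ z
  have h4 := kappa_ne_zero
  have h5 : κ * (𝔡 ModularGroup.S ∣[(2 : ℤ)] γ) z * ((G ∣[k - 2] γ) z - G z) = 0 := by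
    linear_combination -h2
  exact sub_eq_zero.mp ((mul_eq_zero.mp h5).resolve_left (mul_ne_zero h4 h3))

lemma right_slash_apply (h : IsQuasimodularPair k F G) (γ : SL(2, ℤ)) (z : ℍ) :
    (G ∣[k - 2] γ) z = G z :=
  right_slash_apply_of_slash h.slash γ z

lemma smul (h : IsQuasimodularPair k F G) (c : ℂ) :
    IsQuasimodularPair k (c • F) (c • G) where
  left := h.left.smul c
  right := h.right.smul c
  slash γ := by
    ext z
    rw [smul_slash_apply, h.slash_apply]
    simp
    ring

lemma sub (h : IsQuasimodularPair k F G) (h' : IsQuasimodularPair k F' G') :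
    IsQuasimodularPair k (F - F') (G - G') where
  left := h.left.sub h'.left
  right := h.right.sub h'.right
  slash γ := by
    ext z
    rw [sub_slash_apply, h.slash_apply, h'.slash_apply]
    simp
    ring

lemma modularForm_mul {l : ℤ} (h : IsQuasimodularPair k F G) (f : ModularForm 𝒮ℒ l) :
    IsQuasimodularPair (k + l) (f * F) (f * G) where
  left := (HasQSeries.of_modularForm f).mul h.left
  right := (HasQSeries.of_modularForm f).mul h.right
  slash γ := by
    ext z
    have : (f ∣[l] γ : ℍ → ℂ) = f := SlashInvariantForm.slash_action_eqn f _ ⟨γ, rfl⟩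
    rw [mul_slash_apply (add_comm k l), h.slash_apply, this]
    simp
    ring

/-- The Serre derivative of weight `k - 1` sends pairs of weight `k` to pairs of weight `k + 2`. -/
lemma serre (h : IsQuasimodularPair k F G) :
    IsQuasimodularPair (k + 2) (∂[k - 1] F) ((1 / 12 : ℂ) • F + ∂[k - 1] G) where
  left := h.left.serre _
  right := (h.left.smul _).add (h.right.serre _)
  slash γ := by
    ext z
    rw [serreDerivative_eq_sub, serreDerivative_eq_sub, sub_slash_apply, smul_slash_apply,
      mul_slash_apply (add_comm k 2), E2_slash_apply, deriv_slash_apply h.left.mdiff, h.slash γ,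
      deriv_add_smul_mul_D2 h.left.mdiff h.right.mdiff]
    simp
    ring

end IsQuasimodularPair

/-- The Wronskian of the vector-valued form `(z F + G', F)` attached to a pair `(F, G)`, where
`G'` is a multiple of `G`. -/
noncomputable def wronskian (F G : ℍ → ℂ) : ℍ → ℂ :=
  F * F + (12 : ℂ) • (F * 𝔇 G - G * 𝔇 F)

namespace IsQuasimodularPair

variable {k : ℤ} {F G F' G' : ℍ → ℂ}

lemma hasQSeries_wronskian (h : IsQuasimodularPair k F G) : HasQSeries (wronskian F G) :=
  (h.left.mul h.left).add (((h.left.mul h.right.deriv).sub (h.right.mul h.left.deriv)).smul _)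

/-- The Wronskian of a pair of weight `k` is modular of weight `2 k`. -/
lemma wronskian_slash (h : IsQuasimodularPair k F G) (γ : SL(2, ℤ)) :
    wronskian F G ∣[2 * k] γ = wronskian F G := by
  ext z
  have h1 := deriv_slash_apply h.right.mdiff (k - 2) γ z
  have h2 : G ∣[k - 2] γ = G := funext (h.right_slash_apply γ)
  rw [sub_add_cancel, h2] at h1
  rw [wronskian, add_slash_apply, smul_slash_apply, sub_slash_apply,
    mul_slash_apply (two_mul k), mul_slash_apply (two_mul k),
    mul_slash_apply (show 2 * k = (k - 2) + (k + 2) by ring), h1, h2,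
    deriv_slash_apply h.left.mdiff, h.slash γ,
    deriv_add_smul_mul_D2 h.left.mdiff h.right.mdiff]
  simp
  ring

end IsQuasimodularPair

/-! ### Leading coefficients of products and derivatives -/

/-- The power series `p` has order at least `n`, in terms of coefficients. -/
def VanishesBelow (n : ℕ) (p : PowerSeries ℂ) : Prop := ∀ i < n, p.coeff i = 0

namespace VanishesBelow

variable {a b n : ℕ} {p p' : PowerSeries ℂ}

lemma zero (p : PowerSeries ℂ) : VanishesBelow 0 p := fun _ hi ↦ absurd hi (Nat.not_lt_zero _)

lemma mono (h : VanishesBelow a p) (hb : b ≤ a) : VanishesBelow b p :=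
  fun i hi ↦ h i (hi.trans_le hb)

lemma succ (h : VanishesBelow n p) (h' : p.coeff n = 0) : VanishesBelow (n + 1) p := by
  intro i hi
  rcases Nat.lt_succ_iff_lt_or_eq.mp hi with h1 | rfl
  exacts [h i h1, h']

lemma exists_eq (h : VanishesBelow n p) :
    ∃ r : PowerSeries ℂ, p = PowerSeries.X ^ n * r :=
  PowerSeries.X_pow_dvd_iff.mpr h

lemma add (h : VanishesBelow n p) (h' : VanishesBelow n p') : VanishesBelow n (p + p') :=
  fun i hi ↦ by rw [map_add, h i hi, h' i hi, add_zero]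

lemma sub (h : VanishesBelow n p) (h' : VanishesBelow n p') : VanishesBelow n (p - p') :=
  fun i hi ↦ by rw [map_sub, h i hi, h' i hi, sub_zero]

lemma smul (h : VanishesBelow n p) (c : ℂ) : VanishesBelow n (c • p) :=
  fun i hi ↦ by simp [h i hi]

lemma mul (h : VanishesBelow a p) (h' : VanishesBelow b p') :
    VanishesBelow (a + b) (p * p') := by
  obtain ⟨r, rfl⟩ := h.exists_eq
  obtain ⟨s, rfl⟩ := h'.exists_eq
  exact PowerSeries.X_pow_dvd_iff.mp ⟨r * s, by ring⟩

/-- The lowest coefficient of a product. -/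
lemma coeff_mul (h : VanishesBelow a p) (h' : VanishesBelow b p') :
    (p * p').coeff (a + b) = p.coeff a * p'.coeff b := by
  obtain ⟨r, rfl⟩ := h.exists_eq
  obtain ⟨s, rfl⟩ := h'.exists_eq
  rw [show PowerSeries.X ^ a * r * (PowerSeries.X ^ b * s) = PowerSeries.X ^ (a + b) * (r * s) by
    ring]
  simp [PowerSeries.coeff_X_pow_mul']

lemma coeff_mul_self_below (h : VanishesBelow n p') (p : PowerSeries ℂ) :
    (p * p').coeff n = p.coeff 0 * p'.coeff n := by
  simpa using (zero p).coeff_mul h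

lemma coeff_succ_mul (h : VanishesBelow n p') (p : PowerSeries ℂ) :
    (p * p').coeff (n + 1) = p.coeff 0 * p'.coeff (n + 1) + p.coeff 1 * p'.coeff n := by
  obtain ⟨s, rfl⟩ := h.exists_eq
  rw [show p * (PowerSeries.X ^ n * s) = PowerSeries.X ^ n * (p * s) by ring]
  simp [PowerSeries.coeff_X_pow_mul', PowerSeries.coeff_one_mul]
  ring

end VanishesBelow

section

variable {F G : ℍ → ℂ} {n : ℕ}

lemma qExpansion_E2_coeff_zero : (qExpansion 1 𝓔₂).coeff 0 = 1 := by
  simp [qExpansion_E2_coeff]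

lemma qExpansion_E2_coeff_one : (qExpansion 1 𝓔₂).coeff 1 = -24 := by
  simp [qExpansion_E2_coeff]

lemma vanishesBelow_deriv (hF : HasQSeries F) (h : VanishesBelow n (qExpansion 1 F)) :
    VanishesBelow n (qExpansion 1 (𝔇 F)) :=
  fun i hi ↦ by rw [hF.coeff_deriv, h i hi, mul_zero]

lemma qExpansion_serre (hF : HasQSeries F) (s : ℂ) :
    qExpansion 1 (∂[s] F) =
      qExpansion 1 (𝔇 F) - (s / 12) • (qExpansion 1 𝓔₂ * qExpansion 1 F) := by
  rw [serreDerivative_eq_sub, hF.deriv.qExpansion_sub ((hasQSeries_E2.mul hF).smul _),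
    (hasQSeries_E2.mul hF).qExpansion_smul, hasQSeries_E2.qExpansion_mul hF]

lemma vanishesBelow_serre (hF : HasQSeries F) (s : ℂ) (h : VanishesBelow n (qExpansion 1 F)) :
    VanishesBelow n (qExpansion 1 (∂[s] F)) := by
  rw [qExpansion_serre hF]
  refine (vanishesBelow_deriv hF h).sub (VanishesBelow.smul ?_ _)
  simpa using (VanishesBelow.zero _).mul h

lemma coeff_serre (hF : HasQSeries F) (s : ℂ) (h : VanishesBelow n (qExpansion 1 F)) :
    (qExpansion 1 (∂[s] F)).coeff n = (n - s / 12) * (qExpansion 1 F).coeff n := by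
  rw [qExpansion_serre hF, map_sub, hF.coeff_deriv, PowerSeries.coeff_smul,
    h.coeff_mul_self_below, qExpansion_E2_coeff_zero, smul_eq_mul]
  ring

lemma coeff_succ_serre (hF : HasQSeries F) (s : ℂ) (h : VanishesBelow n (qExpansion 1 F)) :
    (qExpansion 1 (∂[s] F)).coeff (n + 1) =
      (n + 1 - s / 12) * (qExpansion 1 F).coeff (n + 1) + 2 * s * (qExpansion 1 F).coeff n := by
  rw [qExpansion_serre hF, map_sub, hF.coeff_deriv, PowerSeries.coeff_smul,
    h.coeff_succ_mul, qExpansion_E2_coeff_zero, qExpansion_E2_coeff_one, smul_eq_mul]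
  push_cast
  ring

lemma qExpansion_modularForm_mul {k : ℤ} (f : ModularForm 𝒮ℒ k) (hF : HasQSeries F) :
    qExpansion 1 (f * F : ℍ → ℂ) = qExpansion 1 f * qExpansion 1 F :=
  (HasQSeries.of_modularForm f).qExpansion_mul hF

lemma vanishesBelow_modularForm_mul {k : ℤ} (f : ModularForm 𝒮ℒ k) (hF : HasQSeries F)
    (h : VanishesBelow n (qExpansion 1 F)) :
    VanishesBelow n (qExpansion 1 (f * F : ℍ → ℂ)) := by
  rw [qExpansion_modularForm_mul f hF]
  simpa using (VanishesBelow.zero _).mul h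

lemma coeff_modularForm_mul {k : ℤ} (f : ModularForm 𝒮ℒ k) (hF : HasQSeries F)
    (h : VanishesBelow n (qExpansion 1 F)) :
    (qExpansion 1 (f * F : ℍ → ℂ)).coeff n =
      (qExpansion 1 f).coeff 0 * (qExpansion 1 F).coeff n := by
  rw [qExpansion_modularForm_mul f hF, h.coeff_mul_self_below]

lemma coeff_succ_modularForm_mul {k : ℤ} (f : ModularForm 𝒮ℒ k) (hF : HasQSeries F)
    (h : VanishesBelow n (qExpansion 1 F)) :
    (qExpansion 1 (f * F : ℍ → ℂ)).coeff (n + 1) =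
      (qExpansion 1 f).coeff 0 * (qExpansion 1 F).coeff (n + 1) +
        (qExpansion 1 f).coeff 1 * (qExpansion 1 F).coeff n := by
  rw [qExpansion_modularForm_mul f hF, h.coeff_succ_mul]

lemma E4_coeff_zero : (qExpansion 1 ModularForm.E₄).coeff 0 = 1 :=
  EisensteinSeries.E_qExpansion_coeff_zero _ ⟨2, rfl⟩

lemma E6_coeff_zero : (qExpansion 1 ModularForm.E₆).coeff 0 = 1 :=
  EisensteinSeries.E_qExpansion_coeff_zero _ ⟨3, rfl⟩

lemma E4_coeff_one : (qExpansion 1 ModularForm.E₄).coeff 1 = 240 :=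
  ModularForm.E₄_qExpansion_coeff_one

lemma E6_coeff_one : (qExpansion 1 ModularForm.E₆).coeff 1 = -504 :=
  ModularForm.E₆_qExpansion_coeff_one

end

/-! ### The bound for the vanishing order -/

namespace IsQuasimodularPair

variable {F G : ℍ → ℂ} {k : ℕ}

/-- If the Wronskian vanishes, so does `F`: otherwise the lowest-order term of the Wronskian can
be read off. -/
lemma eq_zero_of_wronskian_eq_zero (hF : HasQSeries F) (hG : HasQSeries G)
    (hW : wronskian F G = 0) : F = 0 := by
  classical
  refine hF.qExpansion_eq_zero ?_
  by_contra hp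
  set p := qExpansion 1 F with hp_def
  set r := qExpansion 1 G with hr_def
  have hex : ∃ n, p.coeff n ≠ 0 := by
    by_contra! h
    exact hp (PowerSeries.ext h)
  set n := Nat.find hex
  have hn : p.coeff n ≠ 0 := Nat.find_spec hex
  have hpn : VanishesBelow n p := fun i hi ↦ not_not.mp (Nat.find_min hex hi)
  have hpn' : VanishesBelow n (qExpansion 1 (𝔇 F)) := vanishesBelow_deriv hF hpn
  have hexp : p * p + (12 : ℂ) • (p * qExpansion 1 (𝔇 G) - r * qExpansion 1 (𝔇 F)) = 0 := by
    rw [hp_def, hr_def, ← hF.qExpansion_mul hF, ← hF.qExpansion_mul hG.deriv,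
      ← hG.qExpansion_mul hF.deriv,
      ← (hF.mul hG.deriv).qExpansion_sub (hG.mul hF.deriv),
      ← ((hF.mul hG.deriv).sub (hG.mul hF.deriv)).qExpansion_smul,
      ← (hF.mul hF).qExpansion_add (((hF.mul hG.deriv).sub (hG.mul hF.deriv)).smul _)]
    rw [show F * F + (12 : ℂ) • (F * 𝔇 G - G * 𝔇 F) = 0 from hW]
    exact qExpansion_zero 1
  by_cases hr : VanishesBelow n r
  -- if `G` has order at least `n`, the coefficient of `q²ⁿ` is that of `F²`
  · have hr' := vanishesBelow_deriv hG hr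
    have := congr_arg (PowerSeries.coeff (n + n)) hexp
    rw [map_add, PowerSeries.coeff_smul, map_sub, hpn.coeff_mul hpn, hpn.coeff_mul hr',
      hr.coeff_mul hpn', hF.coeff_deriv, hG.coeff_deriv, map_zero, smul_eq_mul] at this
    refine hn (mul_self_eq_zero.mp ?_)
    linear_combination this
  -- if `G` has order `m < n`, the coefficient of `qⁿ⁺ᵐ` comes from `F DG - G DF`
  · have hex' : ∃ m, m < n ∧ r.coeff m ≠ 0 := by
      simpa [VanishesBelow] using hr
    set m := Nat.find hex'
    obtain ⟨hmn, hm⟩ : m < n ∧ r.coeff m ≠ 0 := Nat.find_spec hex'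
    have hrm : VanishesBelow m r := fun i hi ↦ by
      have := Nat.find_min hex' hi
      push Not at this
      exact this (hi.trans hmn)
    have hrm' := vanishesBelow_deriv hG hrm
    have := congr_arg (PowerSeries.coeff (n + m)) hexp
    rw [map_add, PowerSeries.coeff_smul, map_sub, (hpn.mul hpn) _ (by lia), hpn.coeff_mul hrm',
      add_comm n m, hrm.coeff_mul hpn', hF.coeff_deriv, hG.coeff_deriv, map_zero,
      smul_eq_mul] at this
    have h1 : ((m : ℂ) - n) * (p.coeff n * r.coeff m) = 0 := by
      linear_combination this / 12
    rcases mul_eq_zero.mp h1 with h2 | h2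
    · exact hmn.ne (by exact_mod_cast sub_eq_zero.mp h2)
    · exact mul_ne_zero hn hm h2

/-- A quasimodular form of weight `k` and depth at most one with `q`-expansion of order larger
than `k / 6` is zero. The Wronskian is modular of weight `2 k` and its order is at least that of
`F`, so this follows from the bound `2 k / 12` for modular forms. -/
theorem left_eq_zero (h : IsQuasimodularPair k F G)
    (h0 : VanishesBelow (k / 6 + 1) (qExpansion 1 F)) : F = 0 := by
  refine eq_zero_of_wronskian_eq_zero h.left h.right ?_
  refine h.hasQSeries_wronskian.eq_zero_of_slash_invariant (2 * k)
    (fun γ ↦ by simpa using h.wronskian_slash γ) ?_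
  have h1 : VanishesBelow (k / 6 + 1) (qExpansion 1 (wronskian F G)) := by
    rw [wronskian, (h.left.mul h.left).qExpansion_add
        (((h.left.mul h.right.deriv).sub (h.right.mul h.left.deriv)).smul _),
      ((h.left.mul h.right.deriv).sub (h.right.mul h.left.deriv)).qExpansion_smul,
      (h.left.mul h.right.deriv).qExpansion_sub (h.right.mul h.left.deriv),
      h.left.qExpansion_mul h.left, h.left.qExpansion_mul h.right.deriv,
      h.right.qExpansion_mul h.left.deriv]
    have e := VanishesBelow.zero
    refine .add ?_ (.smul (.sub ?_ ?_) _)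
    · simpa using h0.mul (e _)
    · simpa using h0.mul (e _)
    · simpa using (e _).mul (vanishesBelow_deriv h.left h0)
  exact fun m hm ↦ h1 m (by lia)

lemma right_eq_zero {k : ℤ} (h : IsQuasimodularPair k F G) (hF : F = 0) : G = 0 := by
  ext z
  have h1 := h.slash_apply ModularGroup.S z
  have h2 : 𝔡 ModularGroup.S z ≠ 0 := by
    simpa using D2_S_slash_ne_zero 1 z
  rw [hF, SlashAction.zero_slash] at h1
  simpa [kappa_ne_zero, h2] using h1

lemma right_eq_zero_of_vanishesBelow (h : IsQuasimodularPair k F G)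
    (h0 : VanishesBelow (k / 6 + 1) (qExpansion 1 F)) : G = 0 :=
  h.right_eq_zero (h.left_eq_zero h0)

end IsQuasimodularPair

/-! ### Real `q`-expansions -/

/-- All coefficients of the `q`-expansion of `F` are real. -/
def HasRealCoeffs (F : ℍ → ℂ) : Prop :=
  ∀ n, starRingEnd ℂ ((qExpansion 1 F).coeff n) = (qExpansion 1 F).coeff n

namespace HasRealCoeffs

variable {F G : ℍ → ℂ}

lemma add (h : HasRealCoeffs F) (h' : HasRealCoeffs G) (hF : HasQSeries F) (hG : HasQSeries G) :
    HasRealCoeffs (F + G) := fun n ↦ by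
  rw [hF.qExpansion_add hG, map_add, map_add, h n, h' n]

lemma sub (h : HasRealCoeffs F) (h' : HasRealCoeffs G) (hF : HasQSeries F) (hG : HasQSeries G) :
    HasRealCoeffs (F - G) := fun n ↦ by
  rw [hF.qExpansion_sub hG, map_sub, map_sub, h n, h' n]

lemma smul (h : HasRealCoeffs F) (hF : HasQSeries F) {c : ℂ} (hc : starRingEnd ℂ c = c) :
    HasRealCoeffs (c • F) := fun n ↦ by
  rw [hF.qExpansion_smul, PowerSeries.coeff_smul, smul_eq_mul, map_mul, h n, hc]

lemma mul (h : HasRealCoeffs F) (h' : HasRealCoeffs G) (hF : HasQSeries F) (hG : HasQSeries G) :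
    HasRealCoeffs (F * G) := fun n ↦ by
  rw [hF.qExpansion_mul hG, PowerSeries.coeff_mul, map_sum]
  exact Finset.sum_congr rfl fun i _ ↦ by rw [map_mul, h, h']

lemma deriv (h : HasRealCoeffs F) (hF : HasQSeries F) : HasRealCoeffs (𝔇 F) := fun n ↦ by
  rw [hF.coeff_deriv, map_mul, h n, Complex.conj_natCast]

lemma E2 : HasRealCoeffs 𝓔₂ := fun n ↦ by
  rw [qExpansion_E2_coeff]
  split_ifs <;> simp [map_ofNat]

lemma E {k : ℕ} (hk : 3 ≤ k) (hk2 : Even k) : HasRealCoeffs (ModularForm.E hk) := fun n ↦ by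
  rw [EisensteinSeries.E_qExpansion_coeff hk hk2]
  split_ifs <;> simp [map_ofNat]

lemma serre (h : HasRealCoeffs F) (hF : HasQSeries F) {s : ℂ} (hs : starRingEnd ℂ s = s) :
    HasRealCoeffs (∂[s] F) := by
  rw [serreDerivative_eq_sub]
  exact (h.deriv hF).sub
    ((E2.mul h hasQSeries_E2 hF).smul (hasQSeries_E2.mul hF) (by simp [hs, map_ofNat]))
    hF.deriv ((hasQSeries_E2.mul hF).smul _)

end HasRealCoeffs

/-! ### Extremal pairs -/

/-- A quasimodular pair `(F, G)` of weight `k` with real `q`-expansions such that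
`F = qⁿ + O(qⁿ⁺¹)`. -/
structure IsExtremalPair (k n : ℕ) (F G : ℍ → ℂ) : Prop where
  pair : IsQuasimodularPair k F G
  vanishesBelow : VanishesBelow n (qExpansion 1 F)
  coeff_eq_one : (qExpansion 1 F).coeff n = 1
  real_left : HasRealCoeffs F
  real_right : HasRealCoeffs G

/-- `IsQuasimodularPair.serre` with the weights up to propositional equality. -/
lemma IsQuasimodularPair.serre_of_eq {k l : ℤ} {s : ℂ} {F G : ℍ → ℂ}
    (h : IsQuasimodularPair k F G) (hs : s = k - 1) (hl : l = k + 2) :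
    IsQuasimodularPair l (∂[s] F) ((1 / 12 : ℂ) • F + ∂[s] G) := by
  subst hs hl
  exact h.serre

/-- `IsQuasimodularPair.modularForm_mul` with the weight up to propositional equality. -/
lemma IsQuasimodularPair.modularForm_mul_of_eq {k l m : ℤ} {F G : ℍ → ℂ}
    (h : IsQuasimodularPair k F G) (f : ModularForm 𝒮ℒ l) (hm : m = k + l) :
    IsQuasimodularPair m (f * F) (f * G) := by
  subst hm
  exact h.modularForm_mul f

namespace IsExtremalPair

variable {n : ℕ} {F G : ℍ → ℂ}

/-- The second-order operator `∂∂ - ((36 n² - 1) / 144) E₄`, applied to a pair of weight `6 n`. -/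
lemma pair_ode (h : IsExtremalPair (6 * n) n F G) :
    IsQuasimodularPair ((6 * n + 4 : ℕ) : ℤ)
      (∂[6 * n + 1] (∂[6 * n - 1] F) - ((36 * n ^ 2 - 1) / 144 : ℂ) • (E4 * F))
      ((1 / 12 : ℂ) • ∂[6 * n - 1] F + ∂[6 * n + 1] ((1 / 12 : ℂ) • F + ∂[6 * n - 1] G) -
        ((36 * n ^ 2 - 1) / 144 : ℂ) • (E4 * G)) := by
  have h1 := h.pair.serre_of_eq (s := 6 * n - 1) (l := 6 * n + 2) (by push_cast; ring)
    (by push_cast; ring)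
  have h2 := h1.serre_of_eq (s := 6 * n + 1) (l := ((6 * n + 4 : ℕ) : ℤ)) (by push_cast; ring)
    (by push_cast; ring)
  exact h2.sub ((h.pair.modularForm_mul_of_eq E4 (by push_cast; ring)).smul _)

/-- The differential equation of the extremal form of weight `6 n`: the left-hand side has weight
`6 n + 4` and order larger than `n`. -/
lemma ode_left (h : IsExtremalPair (6 * n) n F G) :
    ∂[6 * n + 1] (∂[6 * n - 1] F) - ((36 * n ^ 2 - 1) / 144 : ℂ) • (E4 * F) = 0 := by
  have hF := h.pair.left
  have hE := (HasQSeries.of_modularForm E4).mul hF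
  refine h.pair_ode.left_eq_zero ?_
  have hS := vanishesBelow_serre hF (6 * n - 1) h.vanishesBelow
  rw [show (6 * n + 4) / 6 + 1 = n + 1 by lia,
    ((hF.serre _).serre _).qExpansion_sub (hE.smul _), hE.qExpansion_smul]
  -- `n` is a root of the indicial equation, so the coefficient of `qⁿ` vanishes as well
  refine .succ ((vanishesBelow_serre (hF.serre _) _ hS).sub
    ((vanishesBelow_modularForm_mul E4 hF h.vanishesBelow).smul _)) ?_
  rw [map_sub, coeff_serre (hF.serre _) _ hS, coeff_serre hF _ h.vanishesBelow,
    PowerSeries.coeff_smul, coeff_modularForm_mul E4 hF h.vanishesBelow, E4_coeff_zero, smul_eq_mul]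
  ring

lemma ode_right (h : IsExtremalPair (6 * n) n F G) :
    (1 / 12 : ℂ) • ∂[6 * n - 1] F + ∂[6 * n + 1] ((1 / 12 : ℂ) • F + ∂[6 * n - 1] G) -
      ((36 * n ^ 2 - 1) / 144 : ℂ) • (E4 * G) = 0 :=
  h.pair_ode.right_eq_zero h.ode_left

/-- The coefficient of `qⁿ⁺¹` in `F`, from the coefficient of `qⁿ⁺¹` in `ode_left`. -/
lemma coeff_succ_left (h : IsExtremalPair (6 * n) n F G) :
    (n + 1) * (qExpansion 1 F).coeff (n + 1) = 12 * n * (4 * n - 1) := by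
  have hF := h.pair.left
  have hE := (HasQSeries.of_modularForm E4).mul hF
  have hS := vanishesBelow_serre hF (6 * n - 1) h.vanishesBelow
  have h1 : (qExpansion 1 (∂[6 * n + 1] (∂[6 * n - 1] F) -
      ((36 * n ^ 2 - 1) / 144 : ℂ) • (E4 * F))).coeff (n + 1) = 0 := by
    rw [h.ode_left, qExpansion_zero, map_zero]
  rw [((hF.serre _).serre _).qExpansion_sub (hE.smul _), hE.qExpansion_smul, map_sub,
    coeff_succ_serre (hF.serre _) _ hS, coeff_serre hF _ h.vanishesBelow,
    coeff_succ_serre hF _ h.vanishesBelow,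
    PowerSeries.coeff_smul, coeff_succ_modularForm_mul E4 hF h.vanishesBelow, E4_coeff_zero,
    E4_coeff_one, smul_eq_mul, h.coeff_eq_one] at h1
  linear_combination h1

/-- The ratio of the first two coefficients of `G`, from the coefficient of `q` in `ode_right`. For
`n ≥ 2` the terms in `F` do not contribute to it. -/
lemma coeff_one_right (h : IsExtremalPair (6 * n) n F G) (hn : 2 ≤ n) :
    (n - 1) * (qExpansion 1 G).coeff 1 = -(12 * n * (6 * n - 1)) * (qExpansion 1 G).coeff 0 := by
  have hF := h.pair.left
  have hG := h.pair.right
  have hE := (HasQSeries.of_modularForm E4).mul hG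
  have hS := vanishesBelow_serre hF (6 * n - 1) h.vanishesBelow
  have hFG := (hF.smul (1 / 12)).add (hG.serre (6 * n - 1))
  have h1 : (qExpansion 1 ((1 / 12 : ℂ) • ∂[6 * n - 1] F +
      ∂[6 * n + 1] ((1 / 12 : ℂ) • F + ∂[6 * n - 1] G) -
      ((36 * n ^ 2 - 1) / 144 : ℂ) • (E4 * G))).coeff (0 + 1) = 0 := by
    rw [h.ode_right, qExpansion_zero, map_zero]
  have e := VanishesBelow.zero
  rw [(((hF.serre _).smul _).add (hFG.serre _)).qExpansion_sub (hE.smul _), hE.qExpansion_smul,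
    ((hF.serre _).smul _).qExpansion_add (hFG.serre _), map_sub, map_add,
    (hF.serre _).qExpansion_smul,
    coeff_succ_serre hFG _ (e _), (hF.smul _).qExpansion_add (hG.serre _), map_add, map_add,
    hF.qExpansion_smul, coeff_succ_serre hG _ (e _), coeff_serre hG _ (e _),
    PowerSeries.coeff_smul, PowerSeries.coeff_smul, PowerSeries.coeff_smul, PowerSeries.coeff_smul,
    coeff_succ_modularForm_mul E4 hG (e _), E4_coeff_zero,
    E4_coeff_one, hS _ (by lia), h.vanishesBelow _ (by lia), h.vanishesBelow _ (by lia)] at h1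
  simp only [smul_eq_mul, zero_add] at h1
  push_cast at h1
  linear_combination -h1

/-! ### The recursion for extremal pairs -/

lemma six_mul_add_one_ne_zero (n : ℕ) : (6 * n + 1 : ℂ) ≠ 0 := by
  exact_mod_cast Nat.succ_ne_zero (6 * n)

/-- The normalized Serre derivative of the extremal form of weight `6 n` is extremal of weight
`6 n + 2`. -/
lemma step_two (h : IsExtremalPair (6 * n) n F G) :
    IsExtremalPair (6 * n + 2) n ((12 / (6 * n + 1) : ℂ) • ∂[6 * n - 1] F)
      ((12 / (6 * n + 1) : ℂ) • ((1 / 12 : ℂ) • F + ∂[6 * n - 1] G)) where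
  pair := (h.pair.serre_of_eq (by push_cast; ring) (by push_cast; ring)).smul _
  vanishesBelow := by
    rw [(h.pair.left.serre _).qExpansion_smul]
    exact (vanishesBelow_serre h.pair.left _ h.vanishesBelow).smul _
  coeff_eq_one := by
    rw [(h.pair.left.serre _).qExpansion_smul, PowerSeries.coeff_smul,
      coeff_serre h.pair.left _ h.vanishesBelow, h.coeff_eq_one, smul_eq_mul]
    have := six_mul_add_one_ne_zero n
    field_simp
    ring
  real_left := (h.real_left.serre h.pair.left (by simp [map_ofNat])).smul (h.pair.left.serre _)
    (by simp [map_ofNat])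
  real_right := ((h.real_left.smul h.pair.left (by simp [map_ofNat])).add
    (h.real_right.serre h.pair.right (by simp [map_ofNat])) (h.pair.left.smul _)
      (h.pair.right.serre _)).smul
      ((h.pair.left.smul _).add (h.pair.right.serre _)) (by simp [map_ofNat])

lemma step_four {k : ℕ} (h : IsExtremalPair k n F G) :
    IsExtremalPair (k + 4) n (E4 * F) (E4 * G) where
  pair := h.pair.modularForm_mul_of_eq E4 (by push_cast; ring)
  vanishesBelow := vanishesBelow_modularForm_mul E4 h.pair.left h.vanishesBelow
  coeff_eq_one := by
    rw [coeff_modularForm_mul E4 h.pair.left h.vanishesBelow, h.coeff_eq_one, E4_coeff_zero,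
      one_mul]
  real_left := (HasRealCoeffs.E _ ⟨2, rfl⟩).mul h.real_left (.of_modularForm E4) h.pair.left
  real_right := (HasRealCoeffs.E _ ⟨2, rfl⟩).mul h.real_right (.of_modularForm E4) h.pair.right

/-- In `E₆ X₆ₙ - E₄ X₆ₙ₊₂` the coefficients of `qⁿ` cancel; the next one is explicit and
nonzero, which gives the extremal form of weight `6 n + 6`. -/
lemma step_six (h : IsExtremalPair (6 * n) n F G) :
    IsExtremalPair (6 * (n + 1)) (n + 1)
      ((-((n + 1) / (144 * (6 * n + 5))) : ℂ) •
        (E6 * F - E4 * ((12 / (6 * n + 1) : ℂ) • ∂[6 * n - 1] F)))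
      ((-((n + 1) / (144 * (6 * n + 5))) : ℂ) •
        (E6 * G - E4 * ((12 / (6 * n + 1) : ℂ) • ((1 / 12 : ℂ) • F + ∂[6 * n - 1] G)))) := by
  have h2 := h.step_two
  have hF := h.pair.left
  have h6 := HasQSeries.of_modularForm E6
  have h4 := HasQSeries.of_modularForm E4
  have r6 : HasRealCoeffs E6 := HasRealCoeffs.E _ ⟨3, rfl⟩
  have r4 : HasRealCoeffs E4 := HasRealCoeffs.E _ ⟨2, rfl⟩
  have hs := (h6.mul hF).sub (h4.mul h2.pair.left)
  refine ⟨(IsQuasimodularPair.sub (h.pair.modularForm_mul_of_eq E6 (by push_cast; ring))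
    (h2.pair.modularForm_mul_of_eq E4 (by push_cast; ring))).smul _, ?_, ?_, ?_, ?_⟩
  · rw [hs.qExpansion_smul, (h6.mul hF).qExpansion_sub (h4.mul h2.pair.left)]
    refine VanishesBelow.smul (.succ
      ((vanishesBelow_modularForm_mul E6 hF h.vanishesBelow).sub
        (vanishesBelow_modularForm_mul E4 h2.pair.left h2.vanishesBelow)) ?_) _
    rw [map_sub, coeff_modularForm_mul E6 hF h.vanishesBelow,
      coeff_modularForm_mul E4 h2.pair.left h2.vanishesBelow, h.coeff_eq_one, h2.coeff_eq_one,
      E4_coeff_zero, E6_coeff_zero, sub_self]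
  -- the scalar `-(n + 1) / (144 (6 n + 5))` normalizes the coefficient of `qⁿ⁺¹` to `1`
  · have e1 : (n + 1 : ℂ) ≠ 0 := by exact_mod_cast Nat.succ_ne_zero n
    have e2 := six_mul_add_one_ne_zero n
    have e3 : (6 * n + 5 : ℂ) ≠ 0 := by exact_mod_cast Nat.succ_ne_zero (6 * n + 4)
    have e4 : (qExpansion 1 F).coeff (n + 1) = 12 * n * (4 * n - 1) / (n + 1) := by
      rw [eq_div_iff e1, mul_comm, h.coeff_succ_left]
    rw [hs.qExpansion_smul, (h6.mul hF).qExpansion_sub (h4.mul h2.pair.left),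
      PowerSeries.coeff_smul, map_sub, coeff_succ_modularForm_mul E6 hF h.vanishesBelow,
      coeff_succ_modularForm_mul E4 h2.pair.left h2.vanishesBelow, h.coeff_eq_one,
      h2.coeff_eq_one, E4_coeff_zero, E6_coeff_zero, E4_coeff_one, E6_coeff_one,
      (hF.serre _).qExpansion_smul, PowerSeries.coeff_smul,
      coeff_succ_serre hF _ h.vanishesBelow, h.coeff_eq_one, e4]
    simp only [smul_eq_mul]
    rw [mul_comm] at e2 e3
    field_simp
    ring
  · exact ((r6.mul h.real_left h6 hF).sub (r4.mul h2.real_left h4 h2.pair.left)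
      (h6.mul hF) (h4.mul h2.pair.left)).smul hs (by simp [map_ofNat])
  · exact ((r6.mul h.real_right h6 h.pair.right).sub (r4.mul h2.real_right h4 h2.pair.right)
      (h6.mul h.pair.right) (h4.mul h2.pair.right)).smul
      ((h6.mul h.pair.right).sub (h4.mul h2.pair.right)) (by simp [map_ofNat])

lemma coeff_zero_step_two (h : IsExtremalPair (6 * n) n F G) :
    (qExpansion 1 ((12 / (6 * n + 1) : ℂ) • ((1 / 12 : ℂ) • F + ∂[6 * n - 1] G))).coeff 0 =
      ((qExpansion 1 F).coeff 0 - (6 * n - 1) * (qExpansion 1 G).coeff 0) / (6 * n + 1) := by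
  have hF := h.pair.left
  have hG := h.pair.right
  rw [((hF.smul _).add (hG.serre _)).qExpansion_smul, PowerSeries.coeff_smul,
    (hF.smul _).qExpansion_add (hG.serre _), map_add, hF.qExpansion_smul, PowerSeries.coeff_smul,
    coeff_serre hG _ (.zero _)]
  simp only [smul_eq_mul]
  push_cast
  ring

lemma coeff_zero_step_six (h : IsExtremalPair (6 * n) n F G) :
    (qExpansion 1 ((-((n + 1) / (144 * (6 * n + 5))) : ℂ) •
        (E6 * G - E4 * ((12 / (6 * n + 1) : ℂ) • ((1 / 12 : ℂ) • F + ∂[6 * n - 1] G))))).coeff 0 =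
      (n + 1) * ((qExpansion 1 F).coeff 0 - 12 * n * (qExpansion 1 G).coeff 0) /
        (144 * (6 * n + 5) * (6 * n + 1)) := by
  have hG := h.pair.right
  have h2 := h.step_two.pair.right
  have h6 := (HasQSeries.of_modularForm E6).mul hG
  have h4 := (HasQSeries.of_modularForm E4).mul h2
  have e := VanishesBelow.zero
  have e2 := six_mul_add_one_ne_zero n
  have e3 : (6 * n + 5 : ℂ) ≠ 0 := by exact_mod_cast Nat.succ_ne_zero (6 * n + 4)
  rw [(h6.sub h4).qExpansion_smul, PowerSeries.coeff_smul, h6.qExpansion_sub h4, map_sub,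
    coeff_modularForm_mul E6 hG (e _), coeff_modularForm_mul E4 h2 (e _), h.coeff_zero_step_two,
    E4_coeff_zero, E6_coeff_zero, smul_eq_mul]
  rw [mul_comm] at e2 e3
  field_simp
  ring

/-- The pair `(1, 0)` from which the recursion starts; it has depth zero. -/
lemma one_zero : IsExtremalPair 0 0 (1 : ℍ → ℂ) 0 where
  pair :=
    { left := ⟨mdiff_one, Filter.const_boundedAtFilter _ (1 : ℂ), fun _ ↦ rfl⟩
      right := ⟨mdifferentiable_const (c := (0 : ℂ)), Filter.const_boundedAtFilter _ (0 : ℂ),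
        fun _ ↦ rfl⟩
      slash := fun γ ↦ by
        rw [Nat.cast_zero, ModularForm.is_invariant_one, zero_mul, smul_zero, add_zero] }
  vanishesBelow := .zero _
  coeff_eq_one := by rw [qExpansion_one]; simp
  real_left := fun n ↦ by
    rw [qExpansion_one, PowerSeries.coeff_one]
    split_ifs <;> simp
  real_right := fun n ↦ by rw [qExpansion_zero]; simp

/-- Existence in weight `6 n`, with the sign of the constant term of the second component. -/
theorem exists_weight_six_mul (n : ℕ) (hn : 1 ≤ n) : ∃ F G : ℍ → ℂ,
    IsExtremalPair (6 * n) n F G ∧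
      ∃ a : ℝ, (qExpansion 1 G).coeff 0 = a ∧ (-1) ^ n * a < 0 := by
  induction n, hn using Nat.le_induction with
  | base =>
    have h : IsExtremalPair (6 * 0) 0 (1 : ℍ → ℂ) 0 := one_zero
    refine ⟨_, _, h.step_six, 1 / 720, ?_, by norm_num⟩
    rw [h.coeff_zero_step_six, qExpansion_one, qExpansion_zero]
    norm_num
  | succ n hn ih =>
    obtain ⟨F, G, h, a, ha, hs⟩ := ih
    refine ⟨_, _, h.step_six,
      (n + 1) * (0 - 12 * n * a) / (144 * (6 * n + 5) * (6 * n + 1)), ?_, ?_⟩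
    · rw [h.coeff_zero_step_six, ha, h.vanishesBelow 0 (by lia)]
      push_cast
      ring
    · have hn' : (0 : ℝ) < n := by exact_mod_cast hn
      have : (-1 : ℝ) ^ (n + 1) * ((n + 1) * (0 - 12 * n * a) / (144 * (6 * n + 5) * (6 * n + 1))) =
          (-1) ^ n * a * ((n + 1) * (12 * n) / (144 * (6 * n + 5) * (6 * n + 1))) := by
        rw [pow_succ]
        ring
      rw [this]
      exact mul_neg_of_neg_of_pos hs (by positivity)

end IsExtremalPair

/-! ### The second component of the extremal pairs -/

namespace IsExtremalPair

variable {n : ℕ} {F G : ℍ → ℂ}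

lemma coeff_one_right_eq (h : IsExtremalPair (6 * n) n F G) (hn : 2 ≤ n) {a : ℝ}
    (ha : (qExpansion 1 G).coeff 0 = a) :
    (qExpansion 1 G).coeff 1 = ((-(12 * n * (6 * n - 1) / (n - 1)) * a : ℝ) : ℂ) := by
  have h1 : (n - 1 : ℂ) ≠ 0 := by
    rw [sub_ne_zero]
    exact_mod_cast (show n ≠ 1 by lia)
  have h2 := h.coeff_one_right hn
  rw [ha] at h2
  push_cast
  field_simp
  linear_combination h2

lemma coeff_one_step_two (h : IsExtremalPair (6 * n) n F G) (hn : 2 ≤ n) {a : ℝ}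
    (ha : (qExpansion 1 G).coeff 0 = a) :
    (qExpansion 1 ((12 / (6 * n + 1) : ℂ) • ((1 / 12 : ℂ) • F + ∂[6 * n - 1] G))).coeff 1 =
      ((12 * (6 * n - 1) * (n - 2) / (n - 1) * a : ℝ) : ℂ) := by
  have h1 : (n - 1 : ℂ) ≠ 0 := by
    rw [sub_ne_zero]
    exact_mod_cast (show n ≠ 1 by lia)
  have e2 := six_mul_add_one_ne_zero n
  have hF := h.pair.left
  have hG := h.pair.right
  have h2 := coeff_succ_serre hG (6 * n - 1) (.zero _)
  rw [zero_add] at h2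
  rw [((hF.smul _).add (hG.serre _)).qExpansion_smul, PowerSeries.coeff_smul,
    (hF.smul _).qExpansion_add (hG.serre _), map_add, hF.qExpansion_smul, PowerSeries.coeff_smul,
    h.vanishesBelow 1 (by lia), h2, h.coeff_one_right_eq hn ha, ha]
  simp only [smul_eq_mul]
  push_cast
  rw [div_mul_eq_mul_div, div_eq_iff e2]
  field_simp
  ring

/-- In every even weight `w ≥ 12` there is an extremal pair whose second component has the sign
needed for the behaviour near `t = 0`. The case `w = 14` is degenerate: the coefficient of `q`
vanishes. -/
theorem exists_of_even (w : ℕ) (hw : 12 ≤ w) (hw2 : Even w) : ∃ F G : ℍ → ℂ,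
    IsExtremalPair w (w / 6) F G ∧ (qExpansion 1 G).coeff 0 ≠ 0 ∧
      ∃ b : ℝ, (qExpansion 1 G).coeff 1 = b ∧ (0 < (-1) ^ (w / 2) * b ∨ (b = 0 ∧ w = 14)) := by
  obtain ⟨F, G, h, a, ha, hs⟩ := exists_weight_six_mul (w / 6) (by lia)
  set n := w / 6 with hn
  have hn2 : 2 ≤ n := by lia
  have hnR : (2 : ℝ) ≤ n := by exact_mod_cast hn2
  have ha0 : a ≠ 0 := by
    rintro rfl
    simp at hs
  have hpow (m : ℕ) : (-1 : ℝ) ^ (3 * n + m) = (-1) ^ n * (-1) ^ m := by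
    rw [pow_add, show 3 * n = n + 2 * n by ring, pow_add, pow_mul]
    simp
  have hn1 : (0 : ℝ) < n - 1 := by linarith
  obtain hw0 | hw0 | hw0 : w = 6 * n ∨ w = 6 * n + 2 ∨ w = 6 * n + 4 := by
    obtain ⟨r, hr⟩ := hw2
    lia
  · rw [← hw0] at h
    refine ⟨F, G, h, by rw [ha]; exact_mod_cast ha0, _,
      (hw0 ▸ h : IsExtremalPair (6 * n) n F G).coeff_one_right_eq hn2 ha, .inl ?_⟩
    rw [show w / 2 = 3 * n + 0 by lia, hpow]
    -- the ratio of the first two coefficients is negative, which turns the sign of `a` around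
    have : 0 < 12 * (n : ℝ) * (6 * n - 1) / (n - 1) :=
      div_pos (mul_pos (by linarith) (by linarith)) hn1
    nlinarith
  · have h2 := h.step_two
    rw [← hw0] at h2
    refine ⟨_, _, h2, ?_, _, h.coeff_one_step_two hn2 ha, ?_⟩
    · rw [h.coeff_zero_step_two, ha, h.vanishesBelow 0 (by lia), zero_sub]
      refine div_ne_zero (neg_ne_zero.mpr (mul_ne_zero ?_ (by exact_mod_cast ha0)))
        (six_mul_add_one_ne_zero n)
      rw [sub_ne_zero]
      exact_mod_cast (show 6 * n ≠ 1 by lia)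
    -- the factor `n - 2` vanishes exactly for `w = 14`
    · rcases hn2.eq_or_lt with h3 | h3
      · exact .inr ⟨by rw [← h3]; norm_num, by lia⟩
      · left
        have h3R : (0 : ℝ) < n - 2 := by
          rw [sub_pos]
          exact_mod_cast h3
        rw [show w / 2 = 3 * n + 1 by lia, hpow]
        have : 0 < 12 * (6 * n - 1) * (n - 2) / (n - 1 : ℝ) :=
          div_pos (mul_pos (by linarith) h3R) hn1
        nlinarith
  · have h4 := h.step_four
    rw [← hw0] at h4
    have hz := VanishesBelow.zero (qExpansion 1 G)
    refine ⟨_, _, h4, ?_, (240 - 12 * n * (6 * n - 1) / (n - 1)) * a, ?_, .inl ?_⟩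
    · rw [coeff_modularForm_mul E4 h.pair.right hz, E4_coeff_zero, one_mul, ha]
      exact_mod_cast ha0
    · have := coeff_succ_modularForm_mul E4 h.pair.right hz
      rw [zero_add] at this
      rw [this, E4_coeff_zero, E4_coeff_one, h.coeff_one_right_eq hn2 ha, ha]
      push_cast
      ring
    -- the coefficient `240` of `q` in `E₄` is too small to change the sign of the ratio
    · rw [show w / 2 = 3 * n + 2 by lia, hpow]
      have : 240 - 12 * (n : ℝ) * (6 * n - 1) / (n - 1) < 0 := by
        rw [sub_neg, lt_div_iff₀ hn1]
        nlinarith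
      nlinarith

end IsExtremalPair

/-! ### Behaviour on the imaginary axis -/

section ImAxis

open Filter Topology Asymptotics

variable {F G : ℍ → ℂ}

lemma im_I_mul_pos {t : ℝ} (ht : 0 < t) : 0 < (Complex.I * t).im := by simpa using ht

lemma qParam_I_mul (t : ℝ) :
    Function.Periodic.qParam 1 (Complex.I * t) = (Real.exp (-2 * Real.pi * t) : ℂ) := by
  rw [Function.Periodic.qParam, Complex.ofReal_exp]
  congr 1
  push_cast
  linear_combination (2 * Real.pi * t) * Complex.I_sq

lemma HasQSeries.hasSum_onImAxis (hF : HasQSeries F) {t : ℝ} (ht : 0 < t) :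
    HasSum (fun m : ℕ ↦ (qExpansion 1 F).coeff m • (Real.exp (-2 * Real.pi * t) : ℂ) ^ m)
      (onImAxis F t) := by
  have h := hF.hasSum (ofComplex (Complex.I * t))
  rwa [ofComplex_apply_of_im_pos (im_I_mul_pos ht), coe_mk, qParam_I_mul,
    ← ofComplex_apply_of_im_pos (im_I_mul_pos ht)] at h

lemma HasRealCoeffs.onImAxis_im (h : HasRealCoeffs F) (hF : HasQSeries F) {t : ℝ} (ht : 0 < t) :
    (onImAxis F t).im = 0 := by
  have h1 := hF.hasSum_onImAxis ht
  have h2 := h1.map (starRingEnd ℂ) Complex.continuous_conj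
  refine Complex.conj_eq_iff_im.mp (h2.unique ?_)
  convert! h1 using 2 with m
  simp only [Function.comp_apply, smul_eq_mul, map_mul, map_pow, Complex.conj_ofReal, h m]

lemma tendsto_exp_neg_two_pi :
    Tendsto (fun u : ℝ ↦ (Real.exp (-2 * Real.pi * u) : ℂ)) atTop (𝓝 0) := by
  rw [← Complex.ofReal_zero]
  refine (Complex.continuous_ofReal.tendsto 0).comp (Real.tendsto_exp_atBot.comp ?_)
  exact tendsto_id.const_mul_atTop_of_neg (by linarith [Real.pi_pos])

/-- The leading term of a `q`-series along the imaginary axis. -/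
lemma HasQSeries.tendsto_onImAxis_div (hF : HasQSeries F) {m : ℕ}
    (hm : VanishesBelow m (qExpansion 1 F)) :
    Tendsto (fun u : ℝ ↦ onImAxis F u / (Real.exp (-2 * Real.pi * u) : ℂ) ^ m) atTop
      (𝓝 ((qExpansion 1 F).coeff m)) := by
  set p := qExpansion 1 F
  set f := cuspFunction 1 F
  have hps : HasFPowerSeriesAt f (.ofScalars ℂ fun m ↦ p.coeff m) 0 :=
    (hasFPowerSeriesOnBall_cuspFunction one_pos hF.analyticAt hF.hasSum).hasFPowerSeriesAt
  have hO := hps.isBigO_sub_partialSum_pow (m + 1)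
  have hpart (y : ℂ) : FormalMultilinearSeries.partialSum (.ofScalars ℂ fun m ↦ p.coeff m)
      (m + 1) y = p.coeff m * y ^ m := by
    rw [FormalMultilinearSeries.partialSum, Finset.sum_range_succ, Finset.sum_eq_zero, zero_add]
    · simp [mul_comm]
    · intro i hi
      simp [hm i (Finset.mem_range.mp hi)]
  simp only [zero_add, hpart] at hO
  have hO' := hO.comp_tendsto tendsto_exp_neg_two_pi
  have h0 : Tendsto (fun u : ℝ ↦ (onImAxis F u / (Real.exp (-2 * Real.pi * u) : ℂ) ^ m -
      p.coeff m)) atTop (𝓝 0) := by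
    have hO2 : (fun u : ℝ ↦ (onImAxis F u / (Real.exp (-2 * Real.pi * u) : ℂ) ^ m -
        p.coeff m)) =O[atTop] fun u : ℝ ↦ (Real.exp (-2 * Real.pi * u) : ℂ) := by
      obtain ⟨C, hC⟩ := hO'.bound
      refine .of_bound C ?_
      filter_upwards [hC, eventually_gt_atTop 0] with u hu hu0
      have he : (Real.exp (-2 * Real.pi * u) : ℂ) ≠ 0 := by
        exact_mod_cast (Real.exp_pos _).ne'
      have hval : f (Real.exp (-2 * Real.pi * u) : ℂ) = onImAxis F u := by
        have := eq_cuspFunction (h := 1) (ofComplex (Complex.I * u)) one_ne_zero hF.periodic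
        rwa [ofComplex_apply_of_im_pos (im_I_mul_pos hu0), coe_mk, qParam_I_mul,
          ← ofComplex_apply_of_im_pos (im_I_mul_pos hu0)] at this
      simp only [Function.comp_apply, hval] at hu
      rw [← mul_le_mul_iff_of_pos_right (norm_pos_iff.mpr (pow_ne_zero m he)), ← norm_mul, sub_mul,
        div_mul_cancel₀ _ (pow_ne_zero m he)]
      refine hu.trans_eq ?_
      simp [pow_succ]
      ring
    exact hO2.trans_tendsto tendsto_exp_neg_two_pi
  simpa using h0.add_const (p.coeff m)

lemma HasQSeries.hasDerivAt_onImAxis (hF : HasQSeries F) {u : ℝ} (hu : 0 < u) :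
    HasDerivAt (fun u : ℝ ↦ onImAxis F u) (-2 * Real.pi * onImAxis (𝔇 F) u) u := by
  have h1 : HasDerivAt (F ∘ ofComplex) (_root_.deriv (F ∘ ofComplex) (Complex.I * u))
      (Complex.I * u) :=
    (UpperHalfPlane.mdifferentiableAt_iff.mp (hF.mdiff ⟨_, im_I_mul_pos hu⟩)).hasDerivAt
  have h2 : HasDerivAt (fun u : ℝ ↦ Complex.I * u) Complex.I u := by
    simpa using (Complex.ofRealCLM.hasDerivAt (x := u)).const_mul Complex.I
  have h3 := HasDerivAt.comp u h1 h2
  convert! h3 using 1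
  rw [onImAxis, Derivative.normalizedDerivOfComplex,
    ofComplex_apply_of_im_pos (im_I_mul_pos hu), coe_mk]
  have : (Real.pi : ℂ) ≠ 0 := by exact_mod_cast Real.pi_ne_zero
  have := Complex.I_ne_zero
  field_simp
  rw [Complex.I_sq]
  ring

/-- The transformation `t ↦ 1 / t` on the imaginary axis. -/
lemma IsQuasimodularPair.pow_mul_onImAxis_inv {w : ℕ} (hw : Even w) (hw1 : 1 ≤ w)
    (h : IsQuasimodularPair w F G) {u : ℝ} (hu : 0 < u) :
    ((u⁻¹ ^ (w - 1) : ℝ) : ℂ) * onImAxis F u⁻¹ =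
      ((-1 : ℝ) ^ (w / 2) : ℝ) * (u * onImAxis F u - (6 / Real.pi : ℝ) * onImAxis G u) := by
  have hp : (Real.pi : ℂ) ≠ 0 := by exact_mod_cast Real.pi_ne_zero
  have hu' : (u : ℂ) ≠ 0 := by exact_mod_cast hu.ne'
  set z : ℍ := ofComplex (Complex.I * u) with hz
  have hzc : (z : ℂ) = Complex.I * u := by
    rw [hz, ofComplex_apply_of_im_pos (im_I_mul_pos hu)]
  have hS : ModularGroup.S • z = ofComplex (Complex.I * (u⁻¹ : ℝ)) := by
    rw [ofComplex_apply_of_im_pos (im_I_mul_pos (inv_pos.mpr hu)), UpperHalfPlane.modular_S_smul]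
    ext
    rw [coe_mk, coe_mk, hzc]
    push_cast
    field_simp
    simp
  have hd : denom ModularGroup.S z = (z : ℂ) := by
    rw [ModularGroup.denom_apply]
    simp [ModularGroup.S]
  have h1 := h.slash_apply ModularGroup.S z
  rw [ModularForm.SL_slash_apply, hS, hd, EisensteinSeries.D2_S, hzc] at h1
  change onImAxis F u⁻¹ * _ = onImAxis F u + κ * (onImAxis G u * _) at h1
  have hI : Complex.I ^ w = ((-1 : ℝ) ^ (w / 2) : ℝ) := by
    push_cast
    rw [← Complex.I_sq, ← pow_mul, Nat.mul_div_cancel' hw.two_dvd]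
  have hz0 : (Complex.I * u : ℂ) ≠ 0 := mul_ne_zero Complex.I_ne_zero hu'
  rw [zpow_neg, zpow_natCast, ← div_eq_mul_inv, div_eq_iff (pow_ne_zero _ hz0), mul_pow, hI] at h1
  rw [h1, kappa]
  obtain ⟨v, rfl⟩ : ∃ v, w = v + 1 := ⟨w - 1, by lia⟩
  have := Complex.I_ne_zero
  rw [Nat.add_sub_cancel]
  push_cast
  rw [inv_pow]
  field_simp
  ring

/-- If a real function satisfies `f'/g → c > 0` with `g > 0`, then it is eventually strictly
increasing. -/
lemma exists_strictMonoOn_Ioi {f f' g : ℝ → ℝ} {c : ℝ} (hc : 0 < c)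
    (hf : ∀ u, 0 < u → HasDerivAt f (f' u) u) (hg : ∀ u, 0 < u → 0 < g u)
    (h : Tendsto (fun u ↦ f' u / g u) atTop (𝓝 c)) :
    ∃ M, 0 < M ∧ StrictMonoOn f (Set.Ioi M) := by
  obtain ⟨M, hM⟩ := eventually_atTop.mp (h.eventually_const_lt hc)
  refine ⟨max M 1, by positivity, ?_⟩
  have hpos (u : ℝ) (hu : u ∈ Set.Ioi (max M 1)) : 0 < u :=
    lt_trans (by positivity : (0 : ℝ) < max M 1) hu
  refine strictMonoOn_of_deriv_pos (convex_Ioi _)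
    (fun u hu ↦ (hf u (hpos u hu)).continuousAt.continuousWithinAt) fun u hu ↦ ?_
  rw [interior_Ioi] at hu
  rw [(hf u (hpos u hu)).deriv]
  have h1 := hM u (le_of_lt (lt_of_le_of_lt (le_max_left _ _) hu))
  exact (div_pos_iff_of_pos_right (hg u (hpos u hu))).mp h1

lemma tendsto_mul_exp_neg_two_pi :
    Tendsto (fun u : ℝ ↦ (u : ℂ) * (Real.exp (-2 * Real.pi * u) : ℂ)) atTop (𝓝 0) := by
  have h := tendsto_rpow_mul_exp_neg_mul_atTop_nhds_zero 1 (2 * Real.pi) (by positivity)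
  have h2 := (Complex.continuous_ofReal.tendsto 0).comp h
  simpa [Function.comp_def] using h2

lemma tendsto_ofReal_inv : Tendsto (fun u : ℝ ↦ ((u⁻¹ : ℝ) : ℂ)) atTop (𝓝 0) := by
  rw [← Complex.ofReal_zero]
  exact (Complex.continuous_ofReal.tendsto 0).comp tendsto_inv_atTop_zero

/-- If `F = O(q²)` then the derivative of `u F(iu) - (6 / π) G(iu)` is asymptotic to
`12 b q`, with `b` the coefficient of `q` in `G`. -/
lemma tendsto_deriv_div_exp (hF : HasQSeries F) (hG : HasQSeries G)
    (hF2 : VanishesBelow 2 (qExpansion 1 F)) :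
    Tendsto (fun u : ℝ ↦ (onImAxis F u - 2 * Real.pi * (u * onImAxis (𝔇 F) u) +
      12 * onImAxis (𝔇 G) u) / (Real.exp (-2 * Real.pi * u) : ℂ)) atTop
      (𝓝 (12 * (qExpansion 1 G).coeff 1)) := by
  have hG1 : VanishesBelow 1 (qExpansion 1 (𝔇 G)) := fun i hi ↦ by
    rw [hG.coeff_deriv, Nat.lt_one_iff.mp hi]
    simp
  have h1 := (hF.tendsto_onImAxis_div hF2).mul tendsto_exp_neg_two_pi
  have h2 := (hF.deriv.tendsto_onImAxis_div (vanishesBelow_deriv hF hF2)).mul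
    tendsto_mul_exp_neg_two_pi
  have h3 := hG.deriv.tendsto_onImAxis_div hG1
  have h4 := (h1.sub (h2.const_mul (2 * Real.pi : ℂ))).add (h3.const_mul 12)
  rw [hG.coeff_deriv] at h4
  convert! h4 using 2 with u
  · have he : (Real.exp (-2 * Real.pi * u) : ℂ) ≠ 0 := by exact_mod_cast (Real.exp_pos _).ne'
    field_simp
  · simp

/-- If `F = c q² + O(q³)` and the coefficient of `q` in `G` vanishes, then the derivative of
`u F(iu) - (6 / π) G(iu)` is asymptotic to `-4 π c u q²`. -/
lemma tendsto_deriv_div_mul_exp_sq (hF : HasQSeries F) (hG : HasQSeries G)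
    (hF2 : VanishesBelow 2 (qExpansion 1 F)) (hG1 : (qExpansion 1 G).coeff 1 = 0) :
    Tendsto (fun u : ℝ ↦ (onImAxis F u - 2 * Real.pi * (u * onImAxis (𝔇 F) u) +
      12 * onImAxis (𝔇 G) u) / (u * (Real.exp (-2 * Real.pi * u) : ℂ) ^ 2)) atTop
      (𝓝 (-4 * Real.pi * (qExpansion 1 F).coeff 2)) := by
  have hG2 : VanishesBelow 2 (qExpansion 1 (𝔇 G)) := fun i hi ↦ by
    rw [hG.coeff_deriv]
    interval_cases i
    · simp
    · simp [hG1]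
  have h1 := (hF.tendsto_onImAxis_div hF2).mul tendsto_ofReal_inv
  have h2 := hF.deriv.tendsto_onImAxis_div (vanishesBelow_deriv hF hF2)
  have h3 := (hG.deriv.tendsto_onImAxis_div hG2).mul tendsto_ofReal_inv
  have h4 := (h1.sub (h2.const_mul (2 * Real.pi : ℂ))).add (h3.const_mul 12)
  rw [hF.coeff_deriv] at h4
  refine Tendsto.congr' ?_ (h4.trans_eq ?_)
  · filter_upwards [eventually_gt_atTop 0] with u hu
    have he : (Real.exp (-2 * Real.pi * u) : ℂ) ≠ 0 := by exact_mod_cast (Real.exp_pos _).ne'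
    have hu' : (u : ℂ) ≠ 0 := by exact_mod_cast hu.ne'
    push_cast at he ⊢
    field_simp
  · congr 1
    push_cast
    ring

/-- Monotonicity near `0` follows from the sign of the second component at the cusp. -/
theorem IsQuasimodularPair.exists_strictAntiOn {w : ℕ} (hw : Even w) (hw1 : 1 ≤ w)
    (h : IsQuasimodularPair w F G) (hF2 : VanishesBelow 2 (qExpansion 1 F)) {b : ℝ}
    (hb : (qExpansion 1 G).coeff 1 = b)
    (hs : 0 < (-1) ^ (w / 2) * b ∨
      (b = 0 ∧ (-1 : ℝ) ^ (w / 2) = -1 ∧ (qExpansion 1 F).coeff 2 = 1)) :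
    ∃ ε : ℝ, 0 < ε ∧
      StrictAntiOn (fun t : ℝ ↦ t ^ (w - 1) * (onImAxis F t).re) (Set.Ioo 0 ε) := by
  set s : ℝ := (-1) ^ (w / 2)
  have hF := h.left
  have hG := h.right
  set D : ℝ → ℂ := fun u ↦ onImAxis F u - 2 * Real.pi * (u * onImAxis (𝔇 F) u) +
    12 * onImAxis (𝔇 G) u
  set H : ℝ → ℝ := fun u ↦ (s * (u * onImAxis F u - (6 / Real.pi : ℝ) * onImAxis G u) : ℂ).re
  have hderiv (u : ℝ) (hu : 0 < u) : HasDerivAt H (s * (D u).re) u := by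
    have hp : (Real.pi : ℂ) ≠ 0 := by exact_mod_cast Real.pi_ne_zero
    have h1 : HasDerivAt (fun u : ℝ ↦ (u : ℂ)) 1 u := Complex.ofRealCLM.hasDerivAt
    have h2 := (((h1.mul (hF.hasDerivAt_onImAxis hu)).sub
      ((hG.hasDerivAt_onImAxis hu).const_mul ((6 / Real.pi : ℝ) : ℂ))).const_mul (s : ℂ))
    have h3 := (Complex.reCLM.hasFDerivAt.comp_hasDerivAt u h2)
    convert! h3 using 1
    rw [Complex.reCLM_apply, ← Complex.re_ofReal_mul]
    congr 2
    simp only [D]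
    push_cast
    field_simp
    ring
  obtain ⟨M, hM0, hM⟩ : ∃ M, 0 < M ∧ StrictMonoOn H (Set.Ioi M) := by
    rcases hs with hs | ⟨rfl, hs, hF1⟩
    · refine exists_strictMonoOn_Ioi (c := s * (12 * b)) (g := fun u ↦ Real.exp (-2 * Real.pi * u))
        (by linarith) hderiv (fun u _ ↦ Real.exp_pos _) ?_
      have h1 := (Complex.continuous_re.tendsto _).comp (tendsto_deriv_div_exp hF hG hF2)
      rw [hb, show (12 * (b : ℂ)).re = 12 * b by simp] at h1
      refine (h1.const_mul s).congr fun u ↦ ?_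
      rw [Function.comp_apply, Complex.div_ofReal_re, mul_div_assoc]
    · refine exists_strictMonoOn_Ioi (c := s * (-4 * Real.pi))
        (g := fun u ↦ u * Real.exp (-2 * Real.pi * u) ^ 2)
        (by rw [hs]; linarith [Real.pi_pos]) hderiv
        (fun u hu ↦ mul_pos hu (pow_pos (Real.exp_pos _) 2)) ?_
      have h1 := (Complex.continuous_re.tendsto _).comp
        (tendsto_deriv_div_mul_exp_sq hF hG hF2 (by simpa using hb))
      rw [hF1, show (-4 * (Real.pi : ℂ) * 1).re = -4 * Real.pi by simp] at h1
      refine (h1.const_mul s).congr fun u ↦ ?_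
      rw [Function.comp_apply, ← Complex.ofReal_pow, ← Complex.ofReal_mul, Complex.div_ofReal_re,
        mul_div_assoc]
  have hH (t : ℝ) (ht : 0 < t) : t ^ (w - 1) * (onImAxis F t).re = H t⁻¹ := by
    have h1 := h.pow_mul_onImAxis_inv hw hw1 (inv_pos.mpr ht)
    rw [inv_inv] at h1
    rw [← Complex.re_ofReal_mul, h1]
  refine ⟨M⁻¹, inv_pos.mpr hM0, fun x hx y hy hxy ↦ ?_⟩
  simp only [hH x hx.1, hH y hy.1]
  exact hM ((lt_inv_comm₀ hM0 hy.1).mpr hy.2) ((lt_inv_comm₀ hM0 hx.1).mpr hx.2)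
    ((inv_lt_inv₀ hy.1 hx.1).mpr hxy)

end ImAxis

/-! ### Extremal quasimodular forms of depth one -/

section

variable {k : ℤ} {F G : ℍ → ℂ}

lemma periodic_of_T_slash (h : ∀ z, (F ∣[k] ModularGroup.T) z = F z) :
    Function.Periodic (F ∘ ofComplex) ((1 : ℝ) : ℂ) := by
  intro w
  by_cases! hw : 0 < w.im
  · have hw' : 0 < (w + (1 : ℝ)).im := by simpa using hw
    have h1 := h ⟨w, hw⟩
    rw [ModularForm.SL_slash_apply, ModularGroup.denom_apply, modular_T_smul] at h1
    simp only [Function.comp_apply, ofComplex_apply_of_im_pos hw, ofComplex_apply_of_im_pos hw']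
    have h2 : (⟨w + (1 : ℝ), hw'⟩ : ℍ) = (1 : ℝ) +ᵥ ⟨w, hw⟩ := by
      ext
      simp [add_comm]
    rw [h2]
    simpa [ModularGroup.T] using h1
  · have hw' : (w + (1 : ℝ)).im ≤ 0 := by simpa using hw
    simp only [Function.comp_apply, ofComplex_apply_of_im_nonpos hw,
      ofComplex_apply_of_im_nonpos hw']

lemma kappa_mul_ne_zero : κ * (2 * Real.pi * Complex.I) ≠ 0 :=
  mul_ne_zero kappa_ne_zero Complex.two_pi_I_ne_zero

/-- Quasimodular forms of depth exactly one are the first components of the quasimodular pairs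
with nonzero second component. -/
theorem isQuasimodularForm_one_iff :
    IsQuasimodularForm k 1 F ↔ ∃ G, G ≠ 0 ∧ IsQuasimodularPair k F G := by
  have hc := kappa_mul_ne_zero
  constructor
  · rintro ⟨hF, f, hf, hf1, hslash⟩
    have h0 : f 0 = F := by
      ext z
      simpa using (hslash 1 z).symm
    set G : ℍ → ℂ := (κ * (2 * Real.pi * Complex.I))⁻¹ • f 1
    have hG : f 1 = (κ * (2 * Real.pi * Complex.I)) • G := (smul_inv_smul₀ hc _).symm
    have hs (γ : SL(2, ℤ)) : F ∣[k] γ = F + κ • (G * 𝔡 γ) := by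
      ext z
      rw [hslash γ z, Fin.sum_univ_two, h0, hG]
      simp [EisensteinSeries.D2]
      ring
    refine ⟨G, smul_ne_zero (inv_ne_zero hc) hf1, ⟨hF, h0 ▸ (hf 0).2, ?_⟩,
      ⟨(hf 1).1.const_smul _, Asymptotics.IsBigO.const_smul_left (hf 1).2 _, ?_⟩, hs⟩
    · refine periodic_of_T_slash (k := k) fun z ↦ ?_
      simp [hs, EisensteinSeries.D2_T]
    · exact periodic_of_T_slash (IsQuasimodularPair.right_slash_apply_of_slash hs _)
  · rintro ⟨G, hG, h⟩
    refine ⟨h.left.mdiff, ![F, (κ * (2 * Real.pi * Complex.I)) • G], ?_,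
      smul_ne_zero hc hG, fun γ z ↦ ?_⟩
    · intro r
      fin_cases r
      · exact ⟨h.left.mdiff, h.left.bdd⟩
      · exact ⟨(h.right.smul _).mdiff, (h.right.smul _).bdd⟩
    · rw [h.slash_apply, Fin.sum_univ_two]
      simp [EisensteinSeries.D2]
      ring

lemma vanishesBelow_iff_le_vanishingOrder {n : ℕ} :
    VanishesBelow n (qExpansion 1 F) ↔ (n : ℕ∞) ≤ vanishingOrder F :=
  ⟨fun h ↦ PowerSeries.nat_le_order _ _ h,
    fun h _ hi ↦ PowerSeries.coeff_of_lt_order _ (lt_of_lt_of_le (by exact_mod_cast hi) h)⟩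

lemma IsQuasimodularForm.vanishingOrder_le {w : ℕ} (h : IsQuasimodularForm w 1 F) :
    vanishingOrder F ≤ (w / 6 : ℕ) := by
  obtain ⟨G, hG, hp⟩ := isQuasimodularForm_one_iff.mp h
  by_contra! hlt
  exact hG (hp.right_eq_zero_of_vanishesBelow
    (vanishesBelow_iff_le_vanishingOrder.mpr (Order.add_one_le_of_lt hlt)))

lemma IsExtremalPair.isNormalizedExtremal {w : ℕ} (h : IsExtremalPair w (w / 6) F G)
    (hG : G ≠ 0) : IsNormalizedExtremal w 1 F :=
  ⟨⟨isQuasimodularForm_one_iff.mpr ⟨G, hG, h.pair⟩, fun _ hY ↦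
    hY.vanishingOrder_le.trans (vanishesBelow_iff_le_vanishingOrder.mp h.vanishesBelow)⟩,
    w / 6, h.vanishesBelow, h.coeff_eq_one⟩

lemma IsExtremalPair.eq_of_isNormalizedExtremal {w : ℕ} {X : ℍ → ℂ}
    (h : IsExtremalPair w (w / 6) F G) (hG : G ≠ 0) (hX : IsNormalizedExtremal w 1 X) :
    X = F := by
  obtain ⟨⟨hq, hmax⟩, m, hm, hm1⟩ := hX
  obtain ⟨GX, -, hp⟩ := isQuasimodularForm_one_iff.mp hq
  have hv : VanishesBelow (w / 6) (qExpansion 1 X) :=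
    vanishesBelow_iff_le_vanishingOrder.mpr
      ((vanishesBelow_iff_le_vanishingOrder.mp h.vanishesBelow).trans
        (hmax F (h.isNormalizedExtremal hG).1.1))
  have hle : m ≤ w / 6 := by
    have := (vanishesBelow_iff_le_vanishingOrder.mp hm).trans hq.vanishingOrder_le
    exact_mod_cast this
  have hge : w / 6 ≤ m := by
    by_contra! hlt
    exact one_ne_zero (hm1.symm.trans (hv m hlt))
  obtain rfl : m = w / 6 := le_antisymm hle hge
  refine sub_eq_zero.mp ((hp.sub h.pair).left_eq_zero ?_)
  rw [hp.left.qExpansion_sub h.pair.left]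
  refine (hv.sub h.vanishesBelow).succ ?_
  rw [map_sub, hm1, h.coeff_eq_one, sub_self]

end

theorem mainTheorem8 (w : ℕ) (hw : 12 ≤ w) (hw2 : Even w) :
    (∃! X : ℍ → ℂ, IsNormalizedExtremal (w : ℤ) 1 X) ∧
    ∀ X : ℍ → ℂ, IsNormalizedExtremal (w : ℤ) 1 X →
      (∀ t : ℝ, 0 < t → (onImAxis X t).im = 0) ∧
      ∃ ε : ℝ, 0 < ε ∧
        StrictAntiOn (fun t : ℝ => t ^ (w - 1) * (onImAxis X t).re) (Set.Ioo 0 ε) := by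
  obtain ⟨F, G, h, hG0, b, hb, hs⟩ := IsExtremalPair.exists_of_even w hw hw2
  have hG : G ≠ 0 := by
    rintro rfl
    rw [qExpansion_zero, map_zero] at hG0
    exact hG0 rfl
  refine ⟨⟨F, h.isNormalizedExtremal hG, fun X hX ↦ h.eq_of_isNormalizedExtremal hG hX⟩,
    fun X hX ↦ ?_⟩
  obtain rfl := h.eq_of_isNormalizedExtremal hG hX
  refine ⟨fun t ht ↦ h.real_left.onImAxis_im h.pair.left ht,
    h.pair.exists_strictAntiOn hw2 (by lia) (h.vanishesBelow.mono (by lia)) hb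
      (hs.imp_right ?_)⟩
  rintro ⟨hb0, rfl⟩
  exact ⟨hb0, by norm_num, h.coeff_eq_one⟩
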